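/- \textbf{Setting.} Let $r\ge 1$. Let $F:\mathbb R^r\times\mathbb R\to\mathbb R$, $E:\mathbb R^r\times\mathbb R^r\to\mathbb R$, $f,g:\mathbb R^r\to\mathbb R$, $e:\mathbb R^r\times\mathbb R^r\to\mathbb R^{N_e}$, $h:\mathbb R^r\times\mathbb R\to\mathbb R^{N_h}$ be (locally) Lipschitz continuous, with $g(x)\ne0$ for all $x$. Problem B is to minimize $\int_{-1}^1F(x,u)\,dt+E(x(-1),x(1))$ over the feasible trajectories $(x(t),u(t))\in\mathbb R^r\times\mathbb R$, $t\in[-1,1]$, i.e. those satisfying $$\dot x_1=x_2,\ \dots,\ \dot x_{r-1}=x_r,\ \dot x_r=f(x)+g(x)u,\qquad e(x(-1),x(1))=0,\qquad h(x(t),u(t))\le0 .$$ All derivatives on $(-1,1)$ are weak derivatives ($x$ is continuous on $[-1,1]$), relations between functions of $t$ hold almost everywhere, $\|\cdot\|_\infty$ is the $L^\infty(-1,1)$ norm, $\|\xi\|_{W^{m,2}}=\sum_{j=0}^m\|\xi^{(j)}\|_{L^2(-1,1)}$, $U(\xi)=\|\xi\|_\infty$, and $V(\xi)$ is the total variation of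 $\xi$ on $[-1,1]$ (the least one among the functions equal to $\xi$ almost everywhere). \textbf{Discretization.} Let $L_n$ be the Legendre polynomial of degree $n$; let $t_0=-1<t_1<\dots<t_N=1$ be the Legendre--Gauss--Lobatto nodes ($t_1,\dots,t_{N-1}$ are the roots of $\dot L_N$), $w_k=\frac{2}{N(N+1)}L_N(t_k)^{-2}$, and let $D$ be the $(N+1)\times(N+1)$ matrix with $D_{ik}=\frac{L_N(t_i)}{L_N(t_k)}\frac1{t_i-t_k}$ for $i\ne k$, $D_{00}=-\frac{N(N+1)}4$, $D_{NN}=\frac{N(N+1)}4$, and all other diagonal entries $0$. For $\bar x^{Nk}\in\mathbb R^r$, $\bar u^{Nk}\in\mathbb R$ ($0\le k\le N$) put $\bar x_i^N=(\bar x_i^{N0},\dots,\bar x_i^{NN})$; let $x_i^N(t)$ be the polynomial of degree at most $N$ with $x_i^N(t_k)=\bar x_i^{Nk}$, let $u^N(t)=\frac{\dot x_r^N(t)-f(x^N(t))}{g(x^N(t))}$, and $$a_n^N(m_1)=\left(n+\tfrac12\right)\sum_{k=0}^NL_n(t_k)\,w_k\,\bigl(D^{m_1}(\bar x_r^N)^T\bigr)_k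 .$$ For an integer $m_1\ge1$, a real $\beta>0$ and bounds $\underline b,\bar b\in\mathbb R^{r+1}$, $\underline b_j,\bar b_j\in\mathbb R$ ($1\le j\le m_1-1$), $d\in\mathbb R$, the pair $(\bar x^N,\bar u^N)$ is feasible for Problem $B^N$ if, for all $0\le k\le N$, $$D(\bar x_i^N)^T=(\bar x_{i+1}^N)^T\ (1\le i<r),\qquad \bigl(D(\bar x_r^N)^T\bigr)_k=f(\bar x^{Nk})+g(\bar x^{Nk})\bar u^{Nk},$$ $$\|e(\bar x^{N0},\bar x^{NN})\|_\infty\le(N-r-1)^{-\beta},\qquad h(\bar x^{Nk},\bar u^{Nk})\le(N-r-1)^{-\beta}\mathbf 1,\qquad \underline b\le(\bar x^{Nk},\bar u^{Nk})\le\bar b,$$ $$\underline b_j\le\bigl(D^j(\bar x_r^N)^T\bigr)_0\le\bar b_j\ (1\le j\le m_1-1),\qquad \sum_{n=0}^{N-r-m_1+1}|a_n^N(m_1)|\le d .$$ \textbf{Theorem (existence).} Let $(x,u)$ be a feasible trajectory of Problem B such that $x_r\in W^{m,\infty}(-1,1)$ and $x_r^{(m)}$ has bounded variation, where $m\ge2$,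 and let $m_1$ be an integer with $1\le m_1\le m-1$. Then there is a constant $M>0$ such that the following holds for every real $\beta$ with $0<\beta<(m-m_1)-\frac34$ and for all bounds that are large enough for $(x,u)$ in the following sense: \begin{itemize} \item $(x(t),u(t))$ stays in the interior of the box $[\underline b,\bar b]$ (for some $\varepsilon>0$, at distance at least $\varepsilon$ from its boundary for almost every $t$); \item $\underline b_j<x_r^{(j)}(-1)<\bar b_j$ for $1\le j\le m_1-1$, for the continuous representative of $x_r^{(j)}$; \item $d>\left|\frac12\int_{-1}^1x_r^{(m_1)}(t)\,dt\right|+\frac6{\sqrt\pi}\bigl(U(x_r^{(m_1+1)})+V(x_r^{(m_1+1)})\bigr)\zeta(3/2)$. \end{itemize} There is $N_1>0$ such that for every $N\ge N_1$ Problem $B^N$ has a feasible pair $(\bar x^N,\bar u^N)$ for which $$\|x_i^N-x_i\|_\infty\le\rho_N\ (1\le i\le r),\qquad\|(x_r^N)^{(l)}-x_r^{(l)}\|_\infty\le\rho_N\ (1\le l\le m_1),\qquad\|u^N-u\|_\infty\le\rho_N,$$ $$\text{where}\quad\rho_N=\frac{M\,\|x_r\|_{W^{m,2}}}{(N-r-m_1+1)^{(m-m_1)-3/4}},$$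 and $$|a_n^N(m_1)|\le\frac{6\bigl(U(x_r^{(m_1+1)})+V(x_r^{(m_1+1)})\bigr)}{\sqrt\pi\,n^{3/2}}\qquad(1\le n\le N-r).$$ -/

import Mathlib

open MeasureTheory Set Polynomial
open scoped ContDiff ENNReal Matrix

noncomputable section

namespace PSControl

/-! ### Weak derivatives, Sobolev norms and variation on the interval (-1, 1) -/

/-- Lebesgue measure on the interval `(-1, 1)`. -/
def mu : Measure ℝ := volume.restrict (Ioo (-1) 1)

/-- `v` is a weak derivative of order `j` of `ξ` on `(-1, 1)`. -/
structure HasWeakDeriv (j : ℕ) (ξ v : ℝ → ℝ) : Prop where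
  locInt : LocallyIntegrableOn ξ (Ioo (-1) 1)
  locInt_deriv : LocallyIntegrableOn v (Ioo (-1) 1)
  integral_eq : ∀ φ : ℝ → ℝ, ContDiff ℝ ∞ φ → HasCompactSupport φ → tsupport φ ⊆ Ioo (-1) 1 →
    ∫ t, ξ t * iteratedDeriv j φ t ∂mu = (-1) ^ j * ∫ t, v t * φ t ∂mu

open Classical in
/-- The weak derivative of order `j` of `ξ` on `(-1, 1)`: a representative of it, determined up to
equality almost everywhere (and `0` if there is no weak derivative of that order). -/
def weakDeriv (j : ℕ) (ξ : ℝ → ℝ) : ℝ → ℝ :=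
  if h : ∃ v, HasWeakDeriv j ξ v then h.choose else 0

/-- `ξ` belongs to the Sobolev space `W^{m,p}(-1, 1)`. -/
def MemSobolev (m : ℕ) (p : ℝ≥0∞) (ξ : ℝ → ℝ) : Prop :=
  ∀ j ≤ m, ∃ v, HasWeakDeriv j ξ v ∧ MemLp v p mu

/-- The norm of `W^{m,p}(-1, 1)`: the sum of the `L^p` norms of the weak derivatives of the
orders `0, …, m`. -/
def sobolevNorm (m : ℕ) (p : ℝ≥0∞) (ξ : ℝ → ℝ) : ℝ :=
  ∑ j ∈ Finset.range (m + 1), (eLpNorm (weakDeriv j ξ) p mu).toReal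

/-- The total variation on `[-1, 1]` of a function that is determined up to equality almost
everywhere: the least total variation of a representative. -/
def essVariation (ξ : ℝ → ℝ) : ℝ≥0∞ :=
  ⨅ (w : ℝ → ℝ) (_ : w =ᵐ[mu] ξ), eVariationOn w (Icc (-1) 1)

/-- The least upper bound `U(ξ)` of `|ξ|` up to null sets. -/
def supBound (ξ : ℝ → ℝ) : ℝ := (eLpNorm ξ ⊤ mu).toReal

/-- The total variation `V(ξ)` as a real number. -/
def totalVariation (ξ : ℝ → ℝ) : ℝ := (essVariation ξ).toReal

/-- `ξ ∈ W^{m,∞}(-1, 1)`, and its weak derivative of order `m` has bounded variation. -/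
def HasBVWeakDeriv (m : ℕ) (ξ : ℝ → ℝ) : Prop :=
  MemSobolev m ⊤ ξ ∧ essVariation (weakDeriv m ξ) ≠ ⊤

/-! ### Problem B -/

/-- The last of the indices of the `r` state components. -/
def lastIdx (r : ℕ) [NeZero r] : Fin r := ⟨r - 1, Nat.sub_lt (NeZero.pos r) Nat.one_pos⟩

/-- The data of Problem B: minimize `∫ F(x, u) dt + E(x(-1), x(1))` over the trajectories of
`x₁' = x₂, …, x_{r-1}' = x_r, x_r' = f(x) + g(x) u` subject to `e(x(-1), x(1)) = 0` and
`h(x, u) ≤ 0`. All functions are locally Lipschitz (in particular, they may be globally Lipschitz). -/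
structure ProblemB (r Ne Nh : ℕ) where
  F : (Fin r → ℝ) × ℝ → ℝ
  E : (Fin r → ℝ) × (Fin r → ℝ) → ℝ
  f : (Fin r → ℝ) → ℝ
  g : (Fin r → ℝ) → ℝ
  e : (Fin r → ℝ) × (Fin r → ℝ) → (Fin Ne → ℝ)
  h : (Fin r → ℝ) × ℝ → (Fin Nh → ℝ)
  lip_F : LocallyLipschitz F
  lip_E : LocallyLipschitz E
  lip_f : LocallyLipschitz f
  lip_g : LocallyLipschitz g
  lip_e : LocallyLipschitz e
  lip_h : LocallyLipschitz h
  g_ne_zero : ∀ y, g y ≠ 0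

/-- `(x, u)` is a feasible trajectory of Problem B. The state is continuous on `[-1, 1]`, the state
equation holds in the sense of weak derivatives, the path constraint almost everywhere. -/
structure ProblemB.IsFeasible {r Ne Nh : ℕ} [NeZero r] (P : ProblemB r Ne Nh)
    (x : ℝ → Fin r → ℝ) (u : ℝ → ℝ) : Prop where
  cont : ContinuousOn x (Icc (-1) 1)
  chain : ∀ i j : Fin r, (j : ℕ) = i + 1 → HasWeakDeriv 1 (fun t => x t i) (fun t => x t j)
  last : HasWeakDeriv 1 (fun t => x t (lastIdx r)) (fun t => P.f (x t) + P.g (x t) * u t)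
  endpoint : P.e (x (-1), x 1) = 0
  path : ∀ᵐ t ∂mu, ∀ i, P.h (x t, u t) i ≤ 0

/-! ### Legendre polynomials, LGL nodes and weights, differentiation matrix -/

/-- The Legendre polynomial `L_n`, by the formula of Rodrigues. -/
def legendre (n : ℕ) : ℝ[X] :=
  C (1 / (2 ^ n * (n.factorial : ℝ))) * derivative^[n] ((X ^ 2 - 1) ^ n)

/-- The Legendre-Gauss-Lobatto nodes `t_0 < ⋯ < t_N`: the roots of `(t² - 1) L_N'(t)`, that is,
`-1`, `1` and the roots of `L_N'`, in increasing order. -/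
def node (N : ℕ) (k : Fin (N + 1)) : ℝ :=
  ((((X ^ 2 - 1) * derivative (legendre N) : ℝ[X]).roots.toFinset).sort (· ≤ ·)).getD k 0

/-- The LGL weights. -/
def weight (N : ℕ) (k : Fin (N + 1)) : ℝ :=
  2 / ((N : ℝ) * (N + 1)) * (1 / ((legendre N).eval (node N k)) ^ 2)

/-- The LGL differentiation matrix `D`. -/
def diffMatrix (N : ℕ) : Matrix (Fin (N + 1)) (Fin (N + 1)) ℝ := fun i k =>
  if i ≠ k then
    (legendre N).eval (node N i) / (legendre N).eval (node N k) * (1 / (node N i - node N k))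
  else if (i : ℕ) = 0 then -((N : ℝ) * (N + 1) / 4)
  else if (i : ℕ) = N then (N : ℝ) * (N + 1) / 4
  else 0

/-- The coefficient `a_n^N(m₁)` of `L_n` in the Legendre expansion of the interpolation polynomial
of `D^{m₁} y`, in terms of the nodal values `y`. -/
def specCoeff (N m₁ : ℕ) (y : Fin (N + 1) → ℝ) (n : ℕ) : ℝ :=
  ((n : ℝ) + 1 / 2) *
    ∑ k, (legendre n).eval (node N k) * weight N k * ((diffMatrix N ^ m₁) *ᵥ y) k

/-- The polynomial of degree at most `N` with the values `y` at the LGL nodes. -/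
def interp (N : ℕ) (y : Fin (N + 1) → ℝ) : ℝ[X] :=
  Lagrange.interpolate Finset.univ (node N) y

/-- The interpolant `x^N(t)` of the discrete state `X` (`X k i` is component `i` at node `k`). -/
def interpState {N r : ℕ} (X : Fin (N + 1) → Fin r → ℝ) (t : ℝ) : Fin r → ℝ :=
  fun i => (interp N (fun k => X k i)).eval t

/-- The (in general not polynomial) interpolant `u^N = ((x_r^N)' - f(x^N)) / g(x^N)`. -/
def ProblemB.interpControl {r Ne Nh N : ℕ} [NeZero r] (P : ProblemB r Ne Nh)
    (X : Fin (N + 1) → Fin r → ℝ) (t : ℝ) : ℝ :=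
  ((derivative (interp N (fun k => X k (lastIdx r)))).eval t - P.f (interpState X t)) /
    P.g (interpState X t)

/-! ### Problem B^N -/

/-- The bounds of the search region of Problem `B^N`: for the state, for the control, for the
derivatives of `x_r` of order `j` at `-1`, and for the sum of the spectral coefficients. -/
structure SearchBounds (r : ℕ) where
  lo : Fin r → ℝ
  hi : Fin r → ℝ
  loU : ℝ
  hiU : ℝ
  loD : ℕ → ℝ
  hiD : ℕ → ℝ
  d : ℝ

/-- `(X, Ub)` is a feasible point of Problem `B^N` with the parameters `m₁` and `β`. -/
structure ProblemB.IsDiscreteFeasible {r Ne Nh : ℕ} [NeZero r] (P : ProblemB r Ne Nh)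
    (m₁ : ℕ) (β : ℝ) (b : SearchBounds r) (N : ℕ)
    (X : Fin (N + 1) → Fin r → ℝ) (Ub : Fin (N + 1) → ℝ) : Prop where
  chain : ∀ i j : Fin r, (j : ℕ) = i + 1 →
    diffMatrix N *ᵥ (fun k => X k i) = fun k => X k j
  last : diffMatrix N *ᵥ (fun k => X k (lastIdx r)) = fun k => P.f (X k) + P.g (X k) * Ub k
  endpoint : ‖P.e (X 0, X (Fin.last N))‖ ≤ ((N : ℝ) - r - 1) ^ (-β)
  path : ∀ k i, P.h (X k, Ub k) i ≤ ((N : ℝ) - r - 1) ^ (-β)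
  box_state : ∀ k i, b.lo i ≤ X k i ∧ X k i ≤ b.hi i
  box_control : ∀ k, b.loU ≤ Ub k ∧ Ub k ≤ b.hiU
  box_deriv : ∀ j, 1 ≤ j → j + 1 ≤ m₁ →
    b.loD j ≤ ((diffMatrix N ^ j) *ᵥ (fun k => X k (lastIdx r))) 0 ∧
      ((diffMatrix N ^ j) *ᵥ (fun k => X k (lastIdx r))) 0 ≤ b.hiD j
  spectral : ∑ n ∈ Finset.range (N + 2 - r - m₁),
    |specCoeff N m₁ (fun k => X k (lastIdx r)) n| ≤ b.d

/-- The value `ζ(3/2)`. -/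
def zetaThreeHalves : ℝ := ∑' k : ℕ, 1 / ((k : ℝ) + 1) ^ (3 / 2 : ℝ)

/-- The search region is large enough for the trajectory `(x, u)`: state and control stay in the
interior of their box (away from its boundary, up to null sets), the values at `-1` of the
derivatives of `x_r` of the orders `1, …, m₁ - 1` lie in the interior of their intervals (these
derivatives have continuous representatives), and `d` is larger than the mean of `x_r^{(m₁)}`
in absolute value plus `(6/√π) (U(x_r^{(m₁+1)}) + V(x_r^{(m₁+1)})) ζ(3/2)`. -/
structure SearchBounds.LargeEnough {r : ℕ} [NeZero r] (b : SearchBounds r) (m₁ : ℕ)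
    (x : ℝ → Fin r → ℝ) (u : ℝ → ℝ) : Prop where
  box : ∃ ε > 0, ∀ᵐ t ∂mu,
    (∀ i, b.lo i + ε ≤ x t i ∧ x t i ≤ b.hi i - ε) ∧ b.loU + ε ≤ u t ∧ u t ≤ b.hiU - ε
  deriv : ∀ j, 1 ≤ j → j + 1 ≤ m₁ → ∃ w : ℝ → ℝ, ContinuousOn w (Icc (-1) 1) ∧
    w =ᵐ[mu] weakDeriv j (fun t => x t (lastIdx r)) ∧ b.loD j < w (-1) ∧ w (-1) < b.hiD j
  coeff : |(1 / 2) * ∫ t, weakDeriv m₁ (fun t => x t (lastIdx r)) t ∂mu| +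
    6 / √Real.pi * (supBound (weakDeriv (m₁ + 1) (fun t => x t (lastIdx r))) +
      totalVariation (weakDeriv (m₁ + 1) (fun t => x t (lastIdx r)))) * zetaThreeHalves < b.d

/-- The approximation estimates for the interpolant of `X` with the constant `M`: for all state
components, for the derivatives of `x_r` of the orders `1, …, m₁`, for the control, and for the
spectral coefficients. -/
structure ProblemB.Estimates {r Ne Nh : ℕ} [NeZero r] (P : ProblemB r Ne Nh)
    (x : ℝ → Fin r → ℝ) (u : ℝ → ℝ) (m m₁ : ℕ) (M : ℝ) (N : ℕ)
    (X : Fin (N + 1) → Fin r → ℝ) : Prop where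
  state : ∀ i, eLpNorm (fun t => interpState X t i - x t i) ⊤ mu ≤
    ENNReal.ofReal (M * sobolevNorm m 2 (fun t => x t (lastIdx r)) /
      ((N : ℝ) - r - m₁ + 1) ^ ((m : ℝ) - m₁ - 3 / 4))
  deriv : ∀ l, 1 ≤ l → l ≤ m₁ →
    eLpNorm (fun t => (derivative^[l] (interp N (fun k => X k (lastIdx r)))).eval t -
      weakDeriv l (fun t => x t (lastIdx r)) t) ⊤ mu ≤
    ENNReal.ofReal (M * sobolevNorm m 2 (fun t => x t (lastIdx r)) /
      ((N : ℝ) - r - m₁ + 1) ^ ((m : ℝ) - m₁ - 3 / 4))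
  control : eLpNorm (fun t => P.interpControl X t - u t) ⊤ mu ≤
    ENNReal.ofReal (M * sobolevNorm m 2 (fun t => x t (lastIdx r)) /
      ((N : ℝ) - r - m₁ + 1) ^ ((m : ℝ) - m₁ - 3 / 4))
  coeff : ∀ n : ℕ, 1 ≤ n → n + r ≤ N →
    |specCoeff N m₁ (fun k => X k (lastIdx r)) n| ≤
      6 * (supBound (weakDeriv (m₁ + 1) (fun t => x t (lastIdx r))) +
        totalVariation (weakDeriv (m₁ + 1) (fun t => x t (lastIdx r)))) /
        (√Real.pi * (n : ℝ) ^ (3 / 2 : ℝ))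

end PSControl

end

/-!
The discrete feasible points are built from a polynomial approximation of the highest derivative
that the discretization controls. Let `ξ = x_r^{(m₁)}`, let `p` be its Legendre expansion truncated
at degree `N - r - m₁ + 1`, and integrate `p` repeatedly, with the exact initial values at `-1`, to
polynomial approximations of `x_r^{(m₁ - 1)}, …, x_r, x_{r-1}, …, x_1`, all of degree at most `N`.
The LGL differentiation matrix is exact on such polynomials (`diffMatrix_mulVec`), so their nodal
values satisfy the discrete state equations if the control is defined by the last one. Every other
constraint is a perturbation of a constraint that the trajectory satisfies, and the perturbation is
controlled by `sup |p - ξ|`, since each integration at most doubles the error.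

Two facts about Legendre polynomials give the estimates. The LGL quadrature formula is exact up to
degree `2 N - 1` (`polyInt_eq_sum_weight`), so that the discrete coefficients `a_n^N(m₁)` are the
Legendre coefficients of `p`, that is, those of `ξ` or zero. And `((1 - t²) L_n')² ≤ n` on `[-1, 1]`
(`sq_one_sub_sq_mul_derivative_legendre_le`). As `(1 - t²) L_n'` is, up to the factor
`-n (n + 1)`, a primitive of `L_n` that vanishes at `±1`, integration by parts against a function
`η` of bounded variation gives `|∫ η L_n| ≤ V(η) / (√n (n + 1))` (`abs_legInner_le`). One
integration by parts, in the form `(2 n + 1) ∫ ξ L_n = ∫ ξ' L_{n-1} - ∫ ξ' L_{n+1}`, leads to the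
bound for the spectral coefficients (`IsPrimitive.abs_coeff_le`); `m - m₁` of them show that the
coefficients of `ξ` are `O(n^{-(m - m₁) - 1/2})`. Because `|L_n| ≤ 1`, the Legendre series
converges absolutely, its sum is `ξ` by the density of polynomials, and the tail is
`O(K^{-(m - m₁) + 3/4})` (`exists_legTrunc_rate`).

The weak derivatives of `x_r` are replaced throughout by representatives that are primitives of each
other (`MemSobolev.exists_primitives`), which rests on the lemma of du Bois-Reymond.
-/

noncomputable section

namespace PSControl

/-! ### Differential identities for Legendre polynomials -/

lemma legendre_zero : legendre 0 = 1 := by simp [legendre]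

lemma derivative_sq_sub_one_pow (n : ℕ) :
    derivative ((X ^ 2 - 1 : ℝ[X]) ^ (n + 1)) = C (2 * ((n : ℝ) + 1)) * (X * (X ^ 2 - 1) ^ n) := by
  rw [derivative_pow]
  simp only [derivative_sub, derivative_X_sq, derivative_one, C_mul, C_add, C_eq_natCast]
  simp
  ring

/-- `L_{n+1}` as an `n`-th derivative: the first differentiation in the formula of Rodrigues is
carried out. -/
lemma legendre_succ_eq (n : ℕ) :
    legendre (n + 1) =
      C (1 / (2 ^ n * (n.factorial : ℝ))) * derivative^[n] (X * (X ^ 2 - 1) ^ n) := by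
  rw [legendre, Function.iterate_succ_apply, derivative_sq_sub_one_pow, iterate_derivative_C_mul,
    ← mul_assoc, ← C_mul]
  congr 2
  rw [Nat.factorial_succ]
  have := n.factorial_ne_zero
  push_cast
  field_simp
  ring

lemma legendre_one : legendre 1 = X := by simpa using legendre_succ_eq 0

lemma derivative_legendre_succ (n : ℕ) :
    derivative (legendre (n + 1)) =
      X * derivative (legendre n) + C ((n : ℝ) + 1) * legendre n := by
  rw [legendre_succ_eq, derivative_C_mul, ← Function.iterate_succ_apply' derivative, legendre,
    derivative_C_mul, ← Function.iterate_succ_apply' derivative, mul_comm X (_ ^ n),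
    iterate_derivative_mul_X]
  simp
  ring

lemma derivative_legendre_add_two (n : ℕ) :
    derivative (legendre (n + 2)) =
      derivative (legendre n) + C (2 * (n : ℝ) + 3) * legendre (n + 1) := by
  have h1 : derivative ((X : ℝ[X]) * (X ^ 2 - 1) ^ (n + 1)) =
      C (2 * (n : ℝ) + 3) * (X ^ 2 - 1) ^ (n + 1) + C (2 * ((n : ℝ) + 1)) * (X ^ 2 - 1) ^ n := by
    rw [derivative_mul, derivative_sq_sub_one_pow]
    simp only [C_mul, C_add, C_eq_natCast, derivative_X, map_ofNat]
    simp
    ring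
  rw [legendre_succ_eq, derivative_C_mul, ← Function.iterate_succ_apply' derivative,
    Function.iterate_succ_apply, h1, iterate_map_add, iterate_derivative_C_mul,
    iterate_derivative_C_mul, legendre, legendre, derivative_C_mul,
    ← Function.iterate_succ_apply' derivative, mul_add, ← mul_assoc, ← mul_assoc, ← C_mul, ← C_mul,
    add_comm, ← mul_assoc (C (2 * (n : ℝ) + 3)), ← C_mul (a := 2 * (n : ℝ) + 3)]
  have := n.factorial_ne_zero
  congr 3
  · rw [Nat.factorial_succ]
    push_cast
    field_simp
    ring
  · ring

lemma X_mul_derivative_legendre_succ (n : ℕ) :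
    X * derivative (legendre (n + 1)) =
      derivative (legendre n) + C ((n : ℝ) + 1) * legendre (n + 1) := by
  have h1 := derivative_legendre_succ (n + 1)
  have h2 := derivative_legendre_add_two n
  rw [h2] at h1
  simp only [C_mul, C_add, C_eq_natCast, map_ofNat] at h1 ⊢
  simp at h1 ⊢
  linear_combination -h1

lemma sq_sub_one_mul_derivative_legendre (n : ℕ) :
    (X ^ 2 - 1) * derivative (legendre (n + 1)) =
      C ((n : ℝ) + 1) * (X * legendre (n + 1) - legendre n) := by
  have h1 := derivative_legendre_succ n
  have h2 := X_mul_derivative_legendre_succ n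
  linear_combination X * h2 - h1

/-- The differential equation of Legendre. -/
lemma derivative_sq_sub_one_mul_derivative_legendre (n : ℕ) :
    derivative ((X ^ 2 - 1) * derivative (legendre n)) =
      C ((n : ℝ) * (n + 1)) * legendre n := by
  cases n with
  | zero => simp [legendre_zero]
  | succ n =>
    rw [sq_sub_one_mul_derivative_legendre, derivative_C_mul, derivative_sub, derivative_mul,
      derivative_X, X_mul_derivative_legendre_succ]
    simp only [C_mul, C_add, C_eq_natCast]
    simp
    ring

lemma legendre_eval_one_and_neg_one (n : ℕ) :
    (legendre n).eval 1 = 1 ∧ (legendre n).eval (-1) = (-1) ^ n := by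
  induction n with
  | zero => simp [legendre_zero]
  | succ n ih =>
    have h := sq_sub_one_mul_derivative_legendre n
    have hn : (n : ℝ) + 1 ≠ 0 := by positivity
    have h1 := congrArg (eval 1) h
    have h2 := congrArg (eval (-1)) h
    simp [ih.1, ih.2] at h1 h2
    have h1' := h1.resolve_left hn
    have h2' := h2.resolve_left hn
    refine ⟨by linarith, by rw [pow_succ]; linarith⟩

lemma legendre_eval_one (n : ℕ) : (legendre n).eval 1 = 1 := (legendre_eval_one_and_neg_one n).1

lemma legendre_eval_neg_one (n : ℕ) : (legendre n).eval (-1) = (-1) ^ n :=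
  (legendre_eval_one_and_neg_one n).2

lemma legendre_ne_zero (n : ℕ) : legendre n ≠ 0 := fun h => by
  simpa [h] using legendre_eval_one n

lemma natDegree_legendre_le (n : ℕ) : (legendre n).natDegree ≤ n := by
  refine (natDegree_C_mul_le _ _).trans ((natDegree_iterate_derivative _ _).trans ?_)
  have h : ((X ^ 2 - 1 : ℝ[X]) ^ n).natDegree ≤ n * 2 := by
    refine natDegree_pow_le.trans (Nat.mul_le_mul_left _ ?_)
    compute_degree
  omega

/-! ### Pointwise bounds for Legendre polynomials -/

/-- A function whose derivative has the sign of `t` is at most its value at the endpoints. -/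
lemma le_of_deriv_sign {f f' : ℝ → ℝ} (hf : ∀ t, HasDerivAt f (f' t) t)
    (h0 : ∀ t ∈ Icc (0 : ℝ) 1, 0 ≤ f' t) (h1 : ∀ t ∈ Icc (-1 : ℝ) 0, f' t ≤ 0)
    {c d : ℝ} (hc : ∀ t ∈ ({-1, 1} : Set ℝ), f t ≤ c) (hd : d ≤ f 0) :
    ∀ t ∈ Icc (-1 : ℝ) 1, d ≤ f t ∧ f t ≤ c := by
  have hcont : Continuous f := continuous_iff_continuousAt.2 fun t => (hf t).continuousAt
  have hm : MonotoneOn f (Icc 0 1) := by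
    refine monotoneOn_of_deriv_nonneg (convex_Icc 0 1) hcont.continuousOn
      (fun t _ => (hf t).differentiableAt.differentiableWithinAt) fun t ht => ?_
    rw [(hf t).deriv]; exact h0 t (interior_subset ht)
  have ha : AntitoneOn f (Icc (-1) 0) := by
    refine antitoneOn_of_deriv_nonpos (convex_Icc (-1) 0) hcont.continuousOn
      (fun t _ => (hf t).differentiableAt.differentiableWithinAt) fun t ht => ?_
    rw [(hf t).deriv]; exact h1 t (interior_subset ht)
  intro t ht
  rcases le_total 0 t with h | h
  · exact ⟨hd.trans (hm (by simp) ⟨h, ht.2⟩ h),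
      (hm ⟨h, ht.2⟩ (by simp) ht.2).trans (hc 1 (by simp))⟩
  · exact ⟨hd.trans (ha ⟨ht.1, h⟩ (by simp) h),
      (ha (by simp) ⟨ht.1, h⟩ ht.1).trans (hc (-1) (by simp))⟩

/-- The differential equation of Legendre at a point. -/
lemma legendre_ode_eval (n : ℕ) (t : ℝ) :
    2 * t * (derivative (legendre n)).eval t +
      (t ^ 2 - 1) * (derivative (derivative (legendre n))).eval t =
      n * (n + 1) * (legendre n).eval t := by
  simpa [one_add_one_eq_two] using
    congrArg (eval t) (derivative_sq_sub_one_mul_derivative_legendre n)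

/-- `|L_n| ≤ 1` on `[-1, 1]`, since `n (n + 1) L_n² + (1 - t²) L_n'²` has a derivative of the
sign of `t`. -/
lemma abs_legendre_le_one (n : ℕ) {t : ℝ} (ht : t ∈ Icc (-1 : ℝ) 1) :
    |(legendre n).eval t| ≤ 1 := by
  rcases n.eq_zero_or_pos with rfl | hn
  · simp [legendre_zero]
  set L := legendre n
  set lam : ℝ := n * (n + 1)
  have hlam : 0 < lam := by positivity
  have hder : ∀ t, HasDerivAt (fun t => lam * L.eval t ^ 2 +
      (1 - t ^ 2) * (derivative L).eval t ^ 2) (2 * t * (derivative L).eval t ^ 2) t := by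
    intro t
    have h1 := L.hasDerivAt t
    have h2 := (derivative L).hasDerivAt t
    have h := ((h1.pow 2).const_mul lam).add
      ((((hasDerivAt_id t).pow 2).const_sub 1).mul (h2.pow 2))
    refine h.congr_deriv ?_
    have := legendre_ode_eval n t
    simp
    linear_combination 2 * (derivative L).eval t * (-this)
  have := (le_of_deriv_sign (c := lam) hder
    (fun t ht => mul_nonneg (by linarith [ht.1]) (sq_nonneg _))
    (fun t ht => mul_nonpos_of_nonpos_of_nonneg (by linarith [ht.2]) (sq_nonneg _))
    (by
      rintro t (rfl | rfl)
      · simp [L, legendre_eval_neg_one, ← pow_mul, mul_comm n 2]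
      · simp [L, legendre_eval_one]) le_rfl t ht).2
  have h3 : 0 ≤ (1 - t ^ 2) * (derivative L).eval t ^ 2 :=
    mul_nonneg (by nlinarith [ht.1, ht.2]) (sq_nonneg _)
  rw [← sq_le_one_iff_abs_le_one]
  by_contra hcon
  push Not at hcon
  nlinarith

lemma derivative_legendre_succ_eval_zero (n : ℕ) :
    (derivative (legendre (n + 1))).eval 0 = (n + 1) * (legendre n).eval 0 := by
  simpa using congrArg (eval 0) (derivative_legendre_succ n)

lemma legendre_add_two_eval_zero (n : ℕ) :
    (legendre (n + 2)).eval 0 = -((n + 1) / (n + 2) * (legendre n).eval 0) := by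
  have h := congrArg (eval 0) (X_mul_derivative_legendre_succ (n + 1))
  simp [derivative_legendre_succ_eval_zero] at h
  have hn : (n : ℝ) + 2 ≠ 0 := by positivity
  field_simp
  linear_combination -h

lemma legendre_eval_zero_energy (n : ℕ) :
    ((n : ℝ) + 1) * (legendre n).eval 0 ^ 2 + (n + 2) * (legendre (n + 1)).eval 0 ^ 2 ≤ 1 := by
  induction n using Nat.twoStepInduction with
  | zero => simp [legendre_zero, legendre_one]
  | one =>
    have := legendre_add_two_eval_zero 0
    simp [legendre_zero, legendre_one] at this ⊢
    rw [this]; norm_num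
  | more n ih _ =>
    rw [legendre_add_two_eval_zero n, legendre_add_two_eval_zero (n + 1)]
    push_cast
    refine le_trans (add_le_add ?_ ?_) ih
    · rw [neg_sq, mul_pow, ← mul_assoc]
      refine mul_le_mul_of_nonneg_right ?_ (sq_nonneg _)
      rw [div_pow, mul_div_assoc', div_le_iff₀ (by positivity)]
      nlinarith [(n.cast_nonneg : (0 : ℝ) ≤ n)]
    · rw [neg_sq, mul_pow, ← mul_assoc]
      refine mul_le_mul_of_nonneg_right ?_ (sq_nonneg _)
      rw [div_pow, mul_div_assoc', div_le_iff₀ (by positivity)]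
      nlinarith [(n.cast_nonneg : (0 : ℝ) ≤ n)]

/-- The uniform bound `((1 - t²) L_n')² ≤ n` on `[-1, 1]`, the source of the order `n^{-3/2}` of the
spectral coefficients. For `z = (1 - t²) L_n'` one has `z' = -n (n + 1) L_n`, and the energy
`z² + n (n + 1) (1 - t²) L_n²` has a derivative of the sign of `-t`: it is largest at `0`. -/
lemma sq_one_sub_sq_mul_derivative_legendre_le (n : ℕ) {t : ℝ} (ht : t ∈ Icc (-1 : ℝ) 1) :
    ((t ^ 2 - 1) * (derivative (legendre n)).eval t) ^ 2 ≤ n := by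
  rcases n with _ | n
  · simp [legendre_zero]
  set L := legendre (n + 1)
  set lam : ℝ := (n + 1 : ℕ) * ((n + 1 : ℕ) + 1)
  have hlam : 0 < lam := by positivity
  have hder : ∀ t, HasDerivAt (fun t => -(((t ^ 2 - 1) * (derivative L).eval t) ^ 2 +
      lam * (1 - t ^ 2) * L.eval t ^ 2)) (2 * t * (lam * L.eval t ^ 2)) t := by
    intro t
    have h1 := L.hasDerivAt t
    have h2 := (derivative L).hasDerivAt t
    have h := ((((((hasDerivAt_id t).pow 2).sub_const 1).mul h2).pow 2).add
      (((((hasDerivAt_id t).pow 2).const_sub 1).const_mul lam).mul (h1.pow 2))).neg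
    refine h.congr_deriv ?_
    have := legendre_ode_eval (n + 1) t
    simp
    linear_combination (-2 * (t ^ 2 - 1) * (derivative L).eval t) * this
  have := (le_of_deriv_sign (d := -((n : ℝ) + 1)) (c := 0) hder
    (fun t ht => mul_nonneg (by linarith [ht.1]) (by positivity))
    (fun t ht => mul_nonpos_of_nonpos_of_nonneg (by linarith [ht.2]) (by positivity))
    (by rintro t (rfl | rfl) <;> simp)
    (by
      have h := legendre_eval_zero_energy n
      simp [L, lam, derivative_legendre_succ_eval_zero]
      nlinarith) t ht).1
  have h3 : 0 ≤ lam * (1 - t ^ 2) * L.eval t ^ 2 :=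
    mul_nonneg (mul_nonneg hlam.le (by nlinarith [ht.1, ht.2])) (sq_nonneg _)
  push_cast
  linarith

/-! ### Integrals of polynomials and orthogonality -/

/-- The integral of a polynomial over `[-1, 1]`. -/
def polyInt : ℝ[X] →ₗ[ℝ] ℝ where
  toFun p := ∫ t in (-1 : ℝ)..1, p.eval t
  map_add' p q := by
    simp only [eval_add]
    exact intervalIntegral.integral_add (p.continuous.intervalIntegrable _ _)
      (q.continuous.intervalIntegrable _ _)
  map_smul' c p := by simp

lemma polyInt_apply (p : ℝ[X]) : polyInt p = ∫ t in (-1 : ℝ)..1, p.eval t := rfl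

lemma polyInt_C_mul (c : ℝ) (p : ℝ[X]) : polyInt (C c * p) = c * polyInt p := by
  rw [← smul_eq_C_mul, map_smul, smul_eq_mul]

lemma polyInt_derivative (p : ℝ[X]) : polyInt (derivative p) = p.eval 1 - p.eval (-1) :=
  intervalIntegral.integral_eq_sub_of_hasDerivAt (fun t _ => p.hasDerivAt t)
    ((derivative p).continuous.intervalIntegrable _ _)

lemma polyInt_by_parts (p q : ℝ[X]) :
    polyInt (derivative p * q) =
      p.eval 1 * q.eval 1 - p.eval (-1) * q.eval (-1) - polyInt (p * derivative q) := by
  have h := polyInt_derivative (p * q)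
  rw [derivative_mul, map_add, eval_mul, eval_mul] at h
  linarith

/-- `L_n` is orthogonal to the polynomials of degree less than `n`. -/
lemma polyInt_legendre_mul_eq_zero {n : ℕ} {p : ℝ[X]} (hp : p.natDegree < n) :
    polyInt (legendre n * p) = 0 := by
  have key : ∀ k ≤ n, ∀ p : ℝ[X], p.natDegree < k →
      polyInt (derivative^[k] ((X ^ 2 - 1 : ℝ[X]) ^ n) * p) = 0 := by
    intro k
    induction k with
    | zero => intro _ p hp; omega
    | succ k ih =>
      intro hk p hp
      have hdvd : (X ^ 2 - 1 : ℝ[X]) ∣ derivative^[k] ((X ^ 2 - 1 : ℝ[X]) ^ n) :=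
        (dvd_pow_self _ (by omega)).trans (pow_sub_dvd_iterate_derivative_pow _ n k)
      obtain ⟨c, hc⟩ := hdvd
      have h1 : (derivative^[k] ((X ^ 2 - 1 : ℝ[X]) ^ n)).eval 1 = 0 := by rw [hc]; simp
      have h2 : (derivative^[k] ((X ^ 2 - 1 : ℝ[X]) ^ n)).eval (-1) = 0 := by rw [hc]; simp
      rw [Function.iterate_succ_apply', polyInt_by_parts, h1, h2]
      rcases Nat.eq_zero_or_pos p.natDegree with h0 | h0
      · rw [eq_C_of_natDegree_eq_zero h0]; simp
      · rw [ih (by omega) _ (by have := natDegree_derivative_lt h0.ne'; omega)]; simp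
  rw [legendre, mul_assoc, polyInt_C_mul, key n le_rfl p hp, mul_zero]

lemma natDegree_derivative_legendre_le (n : ℕ) :
    (derivative (legendre n)).natDegree ≤ n - 1 :=
  (natDegree_derivative_le _).trans (Nat.sub_le_sub_right (natDegree_legendre_le n) 1)

lemma polyInt_legendre_mul_self (n : ℕ) :
    polyInt (legendre n * legendre n) = 2 / (2 * n + 1) := by
  rcases n with _ | n
  · have := polyInt_derivative (X : ℝ[X])
    simp [legendre_zero] at this ⊢
    rw [this]; norm_num
  set L := legendre (n + 1)
  have h1 := polyInt_by_parts (L * L) X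
  have h2 : derivative (L * L) * X = 2 * (L * (X * derivative L)) := by
    rw [derivative_mul]; ring
  have h3 : polyInt (L * derivative (legendre n)) = 0 :=
    polyInt_legendre_mul_eq_zero ((natDegree_derivative_legendre_le n).trans_lt (by omega))
  have h4 : 2 * (L * (X * derivative L)) =
      C 2 * (L * derivative (legendre n)) + C (2 * ((n : ℝ) + 1)) * (L * L) := by
    rw [X_mul_derivative_legendre_succ, C_mul, map_ofNat]; ring
  have h5 : ((-1 : ℝ) ^ (n + 1)) * (-1) ^ (n + 1) = 1 := by
    rw [← mul_pow]; simp
  rw [h2, h4, map_add, polyInt_C_mul, polyInt_C_mul, h3] at h1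
  simp [L, legendre_eval_one, legendre_eval_neg_one, h5] at h1
  rw [eq_div_iff (by positivity)]
  push_cast
  linarith

lemma polyInt_legendre_mul_legendre {n k : ℕ} (h : n ≠ k) :
    polyInt (legendre n * legendre k) = 0 := by
  rcases lt_or_gt_of_ne h with h | h
  · rw [mul_comm]
    exact polyInt_legendre_mul_eq_zero ((natDegree_legendre_le n).trans_lt h)
  · exact polyInt_legendre_mul_eq_zero ((natDegree_legendre_le k).trans_lt h)

lemma natDegree_legendre (n : ℕ) : (legendre n).natDegree = n := by
  refine (natDegree_legendre_le n).antisymm (not_lt.1 fun h => ?_)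
  have h1 := polyInt_legendre_mul_eq_zero h
  rw [polyInt_legendre_mul_self] at h1
  exact absurd h1 (by positivity)

/-- The Legendre polynomials as a sequence of polynomials of the degrees `0, 1, 2, …`. -/
def legendreSeq : Polynomial.Sequence ℝ where
  elems' := legendre
  degree_eq' n := by
    rw [degree_eq_natDegree (legendre_ne_zero n), natDegree_legendre]

lemma span_range_legendre : Submodule.span ℝ (Set.range legendre) = ⊤ :=
  legendreSeq.span fun i => (leadingCoeff_ne_zero.2 (legendre_ne_zero i)).isUnit

/-! ### Legendre-Gauss-Lobatto nodes -/

/-- The polynomial `(X² - 1) L_N'` that vanishes at the nodes. -/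
def nodePoly (N : ℕ) : ℝ[X] := (X ^ 2 - 1) * derivative (legendre N)

lemma derivative_nodePoly (N : ℕ) :
    derivative (nodePoly N) = C ((N : ℝ) * (N + 1)) * legendre N :=
  derivative_sq_sub_one_mul_derivative_legendre N

lemma natDegree_nodePoly_le {N : ℕ} (hN : 1 ≤ N) : (nodePoly N).natDegree ≤ N + 1 := by
  have h : (X ^ 2 - 1 : ℝ[X]).natDegree ≤ 2 := by compute_degree
  have := natDegree_derivative_legendre_le N
  refine natDegree_mul_le.trans ?_
  omega

lemma derivative_legendre_ne_zero {N : ℕ} (hN : 1 ≤ N) : derivative (legendre N) ≠ 0 := fun h => by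
  have := derivative_eq_zero.1 h
  rw [natDegree_legendre] at this
  omega

lemma sq_sub_one_ne_zero : (X ^ 2 - 1 : ℝ[X]) ≠ 0 := fun h => by
  simpa using congrArg (eval 0) h

lemma nodePoly_ne_zero {N : ℕ} (hN : 1 ≤ N) : nodePoly N ≠ 0 :=
  mul_ne_zero sq_sub_one_ne_zero (derivative_legendre_ne_zero hN)

/-- Up to a constant factor, `(X² - 1) L_N'` is the derivative of order `N - 1` of `(X² - 1)^N`. -/
lemma nodePoly_eq {N : ℕ} (hN : 1 ≤ N) : ∃ c : ℝ, c ≠ 0 ∧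
    nodePoly N = C c * derivative^[N - 1] ((X ^ 2 - 1) ^ N) := by
  obtain ⟨n, rfl⟩ : ∃ n, N = n + 1 := ⟨N - 1, by omega⟩
  refine ⟨((n + 1 : ℕ) : ℝ) * ((n + 1 : ℕ) + 1) *
    (1 / (2 ^ (n + 1) * ((n + 1).factorial : ℝ))), by positivity, ?_⟩
  set c := ((n + 1 : ℕ) : ℝ) * ((n + 1 : ℕ) + 1) * (1 / (2 ^ (n + 1) * ((n + 1).factorial : ℝ)))
  have h : derivative (nodePoly (n + 1) - C c * derivative^[n] ((X ^ 2 - 1) ^ (n + 1))) = 0 := by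
    rw [derivative_sub, derivative_nodePoly, derivative_C_mul,
      ← Function.iterate_succ_apply' derivative, legendre, ← mul_assoc, ← C_mul, sub_self]
  have h2 := eq_C_of_natDegree_eq_zero (derivative_eq_zero.1 h)
  obtain ⟨q, hq⟩ : (X ^ 2 - 1 : ℝ[X]) ∣ derivative^[n] ((X ^ 2 - 1 : ℝ[X]) ^ (n + 1)) :=
    (dvd_pow_self _ (by omega)).trans (pow_sub_dvd_iterate_derivative_pow _ (n + 1) n)
  have h3 : (nodePoly (n + 1) - C c * derivative^[n] ((X ^ 2 - 1) ^ (n + 1))).eval 1 = 0 := by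
    rw [hq, nodePoly]; simp
  rw [h2, eval_C] at h3
  rw [h3, C_0] at h2
  exact sub_eq_zero.1 h2

lemma card_roots_nodePoly {N : ℕ} (hN : 1 ≤ N) : N + 1 ≤ (nodePoly N).roots.card := by
  obtain ⟨c, hc, h⟩ := nodePoly_eq hN
  rw [h, roots_C_mul _ hc]
  have key : ∀ k, 2 * N ≤ (derivative^[k] ((X ^ 2 - 1 : ℝ[X]) ^ N)).roots.card + k := by
    intro k
    induction k with
    | zero =>
      have : (X ^ 2 - 1 : ℝ[X]) = (X - C 1) * (X - C (-1)) := by simp; ring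
      rw [Function.iterate_zero_apply, roots_pow, this,
        roots_mul (mul_ne_zero (X_sub_C_ne_zero _) (X_sub_C_ne_zero _)), roots_X_sub_C,
        roots_X_sub_C]
      simp
      omega
    | succ k ih =>
      rw [Function.iterate_succ_apply']
      have := card_roots_le_derivative (derivative^[k] ((X ^ 2 - 1 : ℝ[X]) ^ N))
      omega
  have := key (N - 1)
  omega

lemma nodup_roots_nodePoly {N : ℕ} (hN : 1 ≤ N) : (nodePoly N).roots.Nodup := by
  have hq := nodePoly_ne_zero hN
  have hlam : (N : ℝ) * (N + 1) ≠ 0 := by positivity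
  rw [Multiset.nodup_iff_count_le_one]
  intro t
  rw [count_roots]
  by_contra hcon
  push Not at hcon
  have hroot : (nodePoly N).IsRoot t := (rootMultiplicity_pos hq).1 (by omega)
  have hd := derivative_rootMultiplicity_of_root hroot
  rw [derivative_nodePoly, rootMultiplicity_mul (mul_ne_zero (C_ne_zero.2 hlam)
    (legendre_ne_zero N)), rootMultiplicity_C, zero_add] at hd
  have hL : (legendre N).IsRoot t := (rootMultiplicity_pos (legendre_ne_zero N)).1 (by omega)
  have ht : ¬ (X ^ 2 - 1 : ℝ[X]).IsRoot t := by
    intro h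
    have h' : (t - 1) * (t + 1) = 0 := by
      have : t ^ 2 - 1 = 0 := by simpa using h
      linarith
    rcases mul_eq_zero.1 h' with h | h
    · rw [show t = 1 by linarith, IsRoot, legendre_eval_one] at hL
      norm_num at hL
    · rw [show t = -1 by linarith, IsRoot, legendre_eval_neg_one] at hL
      exact absurd hL (by simp)
  have h1 : (nodePoly N).rootMultiplicity t = (derivative (legendre N)).rootMultiplicity t := by
    rw [nodePoly, rootMultiplicity_mul hq, rootMultiplicity_eq_zero ht, zero_add]
  rw [derivative_rootMultiplicity_of_root hL] at h1
  omega

lemma roots_nodePoly_mem {N : ℕ} (hN : 1 ≤ N) {t : ℝ} (ht : (nodePoly N).IsRoot t) :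
    t ∈ Icc (-1 : ℝ) 1 := by
  obtain ⟨c, hc, h⟩ := nodePoly_eq hN
  have key : ∀ k ≤ N, ∀ z : ℂ, (derivative^[k] ((X ^ 2 - 1 : ℂ[X]) ^ N)).IsRoot z →
      z ∈ segment ℝ (-1 : ℂ) 1 := by
    intro k
    induction k with
    | zero =>
      intro _ z hz
      have h1 : z ^ 2 - 1 = 0 := by
        simpa [IsRoot, show N ≠ 0 by omega] using hz
      have h2 : (z - 1) * (z + 1) = 0 := by linear_combination h1
      rcases mul_eq_zero.1 h2 with h | h
      · rw [show z = 1 by linear_combination h]; exact right_mem_segment ..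
      · rw [show z = -1 by linear_combination h]; exact left_mem_segment ..
    | succ k ih =>
      intro hk z hz
      rw [Function.iterate_succ_apply'] at hz
      set P := derivative^[k] ((X ^ 2 - 1 : ℂ[X]) ^ N) with hP
      have hdP : derivative P ≠ 0 := by
        intro h0
        have hdeg := derivative_eq_zero.1 h0
        have hc := coeff_iterate_derivative (k := k) ((X ^ 2 - 1 : ℂ[X]) ^ N) (2 * N - k)
        have hmonic : ((X ^ 2 - 1 : ℂ[X]) ^ N).coeff (2 * N) = 1 := by
          have h1 : (X ^ 2 - 1 : ℂ[X]).Monic := by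
            simpa using monic_X_pow_sub_C (1 : ℂ) (n := 2) (by norm_num)
          have h2 : ((X ^ 2 - 1 : ℂ[X]) ^ N).natDegree = 2 * N := by
            rw [h1.natDegree_pow, mul_comm, show (1 : ℂ[X]) = C 1 from rfl, natDegree_X_pow_sub_C]
          have h3 := (h1.pow N).coeff_natDegree
          rwa [h2] at h3
        rw [← hP, show 2 * N - k + k = 2 * N by omega, hmonic,
          coeff_eq_zero_of_natDegree_lt (by omega)] at hc
        rw [nsmul_one, eq_comm, Nat.cast_eq_zero, Nat.descFactorial_eq_zero_iff_lt] at hc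
        omega
      have hpos : 0 < P.degree := by
        by_contra hle
        rw [eq_C_of_degree_le_zero (not_lt.1 hle), derivative_C] at hdP
        exact hdP rfl
      have hmem : z ∈ (derivative P).rootSet ℂ := by
        rw [mem_rootSet]
        exact ⟨hdP, by simpa using hz⟩
      refine convexHull_min ?_ (convex_segment _ _)
        (rootSet_derivative_subset_convexHull_rootSet hpos hmem)
      intro w hw
      rw [mem_rootSet] at hw
      exact ih (by omega) w (by simpa using hw.2)
  have h1 : (derivative^[N - 1] ((X ^ 2 - 1 : ℝ[X]) ^ N)).eval t = 0 := by
    rw [h, IsRoot, eval_mul, eval_C] at ht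
    exact (mul_eq_zero.1 ht).resolve_left hc
  have h2 : (derivative^[N - 1] ((X ^ 2 - 1 : ℂ[X]) ^ N)).IsRoot (t : ℂ) := by
    have h3 : (X ^ 2 - 1 : ℂ[X]) ^ N = ((X ^ 2 - 1 : ℝ[X]) ^ N).map Complex.ofRealHom := by simp
    rw [h3, iterate_derivative_map, IsRoot, ← Complex.ofRealHom_eq_coe, eval_map_apply, h1,
      map_zero]
  have h4 := key (N - 1) (by omega) _ h2
  obtain ⟨a, b, ha, hb, hab, hz⟩ := h4
  have h5 : b - a = t := by
    have := congrArg Complex.re hz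
    simp at this
    linarith
  constructor <;> linarith

lemma card_toFinset_roots_nodePoly {N : ℕ} (hN : 1 ≤ N) :
    (nodePoly N).roots.toFinset.card = N + 1 := by
  rw [Multiset.toFinset_card_of_nodup (nodup_roots_nodePoly hN)]
  exact ((card_roots' _).trans (natDegree_nodePoly_le hN)).antisymm (card_roots_nodePoly hN)

lemma node_eq_orderEmbOfFin {N : ℕ} (hN : 1 ≤ N) (k : Fin (N + 1)) :
    node N k = (nodePoly N).roots.toFinset.orderEmbOfFin (card_toFinset_roots_nodePoly hN) k := by
  rw [Finset.orderEmbOfFin_apply]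
  exact List.getD_eq_getElem _ _ _

lemma node_strictMono {N : ℕ} (hN : 1 ≤ N) : StrictMono (node N) := fun i j hij => by
  rw [node_eq_orderEmbOfFin hN, node_eq_orderEmbOfFin hN]
  exact (Finset.orderEmbOfFin _ _).strictMono hij

lemma node_injective {N : ℕ} (hN : 1 ≤ N) : Function.Injective (node N) :=
  (node_strictMono hN).injective

lemma nodePoly_eval_node {N : ℕ} (hN : 1 ≤ N) (k : Fin (N + 1)) :
    (nodePoly N).eval (node N k) = 0 := by
  have := Finset.orderEmbOfFin_mem _ (card_toFinset_roots_nodePoly hN) k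
  rw [← node_eq_orderEmbOfFin hN, Multiset.mem_toFinset] at this
  exact isRoot_of_mem_roots this

lemma node_mem_Icc {N : ℕ} (hN : 1 ≤ N) (k : Fin (N + 1)) : node N k ∈ Icc (-1 : ℝ) 1 :=
  roots_nodePoly_mem hN (nodePoly_eval_node hN k)

lemma exists_node_eq {N : ℕ} (hN : 1 ≤ N) {t : ℝ} (ht : (nodePoly N).eval t = 0) :
    ∃ k, node N k = t := by
  have h1 : t ∈ ((nodePoly N).roots.toFinset : Set ℝ) := by
    simpa using ⟨nodePoly_ne_zero hN, ht⟩
  rw [← Finset.range_orderEmbOfFin _ (card_toFinset_roots_nodePoly hN)] at h1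
  obtain ⟨k, hk⟩ := h1
  exact ⟨k, (node_eq_orderEmbOfFin hN k).trans hk⟩

lemma node_zero {N : ℕ} (hN : 1 ≤ N) : node N 0 = -1 := by
  obtain ⟨k, hk⟩ := exists_node_eq hN (t := -1) (by simp [nodePoly])
  refine le_antisymm ?_ (node_mem_Icc hN 0).1
  rw [← hk]
  exact (node_strictMono hN).monotone (Fin.zero_le k)

lemma node_last {N : ℕ} (hN : 1 ≤ N) : node N (Fin.last N) = 1 := by
  obtain ⟨k, hk⟩ := exists_node_eq hN (t := 1) (by simp [nodePoly])
  refine le_antisymm (node_mem_Icc hN _).2 ?_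
  rw [← hk]
  exact (node_strictMono hN).monotone (Fin.le_last k)

lemma legendre_eval_node_ne_zero {N : ℕ} (hN : 1 ≤ N) (k : Fin (N + 1)) :
    (legendre N).eval (node N k) ≠ 0 := by
  intro h
  have hq := nodePoly_ne_zero hN
  have hr : (nodePoly N).IsRoot (node N k) := nodePoly_eval_node hN k
  have h1 : 1 < (nodePoly N).rootMultiplicity (node N k) := by
    rw [one_lt_rootMultiplicity_iff_isRoot hq]
    exact ⟨hr, by rw [derivative_nodePoly, IsRoot, eval_mul, h, mul_zero]⟩
  have h2 := Multiset.nodup_iff_count_le_one.1 (nodup_roots_nodePoly hN) (node N k)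
  rw [count_roots] at h2
  omega

/-- Polynomials of degree at most `N` are determined by their values at the nodes. -/
lemma eq_of_eval_node_eq {N : ℕ} (hN : 1 ≤ N) {p q : ℝ[X]} (hp : p.natDegree ≤ N)
    (hq : q.natDegree ≤ N) (h : ∀ k, p.eval (node N k) = q.eval (node N k)) : p = q := by
  refine eq_of_degrees_lt_of_eval_index_eq (v := node N) Finset.univ
    (node_injective hN).injOn ?_ ?_ fun k _ => h k
  · rw [Finset.card_univ, Fintype.card_fin]
    exact degree_le_natDegree.trans_lt (by exact_mod_cast Nat.lt_succ_of_le hp)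
  · rw [Finset.card_univ, Fintype.card_fin]
    exact degree_le_natDegree.trans_lt (by exact_mod_cast Nat.lt_succ_of_le hq)

lemma interp_eval_node {N : ℕ} (hN : 1 ≤ N) {p : ℝ[X]} (hp : p.natDegree ≤ N) :
    interp N (fun k => p.eval (node N k)) = p := by
  refine (Lagrange.eq_interpolate_of_eval_eq _ (node_injective hN).injOn ?_ fun k _ => rfl).symm
  rw [Finset.card_univ, Fintype.card_fin]
  exact degree_le_natDegree.trans_lt (by exact_mod_cast Nat.lt_succ_of_le hp)

/-! ### The Lagrange basis at the nodes and the differentiation matrix -/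

/-- The polynomial `ℓ_k` of degree `N` with the value `1` at the node `k` and `0` at the other
nodes, as the quotient of `(X² - 1) L_N'` by its linear factor. -/
def nodeBasis (N : ℕ) (k : Fin (N + 1)) : ℝ[X] :=
  C (1 / ((N : ℝ) * (N + 1) * (legendre N).eval (node N k))) *
    (nodePoly N /ₘ (X - C (node N k)))

lemma X_sub_C_mul_nodeBasis {N : ℕ} (hN : 1 ≤ N) (k : Fin (N + 1)) :
    (X - C (node N k)) * nodeBasis N k =
      C (1 / ((N : ℝ) * (N + 1) * (legendre N).eval (node N k))) * nodePoly N := by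
  have h := mul_divByMonic_eq_iff_isRoot.2 (show (nodePoly N).IsRoot (node N k) from
    nodePoly_eval_node hN k)
  rw [nodeBasis, mul_left_comm, h]

lemma natDegree_nodeBasis_le {N : ℕ} (hN : 1 ≤ N) (k : Fin (N + 1)) :
    (nodeBasis N k).natDegree ≤ N := by
  refine (natDegree_C_mul_le _ _).trans ?_
  rw [natDegree_divByMonic _ (monic_X_sub_C _), natDegree_X_sub_C]
  have := natDegree_nodePoly_le hN
  omega

/-- The derivative of the identity `X_sub_C_mul_nodeBasis`. -/
lemma X_sub_C_mul_derivative_nodeBasis {N : ℕ} (hN : 1 ≤ N) (k : Fin (N + 1)) :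
    nodeBasis N k + (X - C (node N k)) * derivative (nodeBasis N k) =
      C (1 / (legendre N).eval (node N k)) * legendre N := by
  have h := congrArg derivative (X_sub_C_mul_nodeBasis hN k)
  rw [derivative_mul, derivative_X_sub_C, one_mul, derivative_C_mul, derivative_nodePoly,
    ← mul_assoc, ← C_mul] at h
  rw [h]
  have := legendre_eval_node_ne_zero hN k
  have hN' : (N : ℝ) ≠ 0 := by positivity
  congr 2
  field_simp

lemma nodeBasis_eval_node {N : ℕ} (hN : 1 ≤ N) (k i : Fin (N + 1)) :
    (nodeBasis N k).eval (node N i) = if i = k then 1 else 0 := by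
  split_ifs with h
  · subst h
    have h := congrArg (eval (node N i)) (X_sub_C_mul_derivative_nodeBasis hN i)
    simpa [legendre_eval_node_ne_zero hN i] using h
  · have h1 := congrArg (eval (node N i)) (X_sub_C_mul_nodeBasis hN k)
    rw [eval_mul, eval_mul, nodePoly_eval_node hN, mul_zero] at h1
    refine (mul_eq_zero.1 h1).resolve_left ?_
    simpa [sub_eq_zero] using fun h' => h (node_injective hN h')

lemma eq_sum_nodeBasis {N : ℕ} (hN : 1 ≤ N) {p : ℝ[X]} (hp : p.natDegree ≤ N) :
    p = ∑ k, C (p.eval (node N k)) * nodeBasis N k := by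
  refine eq_of_eval_node_eq hN hp (natDegree_sum_le_of_forall_le _ _ fun k _ =>
    (natDegree_C_mul_le _ _).trans (natDegree_nodeBasis_le hN k)) fun i => ?_
  simp [eval_finsetSum, nodeBasis_eval_node hN]

lemma derivative_legendre_eval_node {N : ℕ} (hN : 1 ≤ N) {k : Fin (N + 1)} (h0 : (k : ℕ) ≠ 0)
    (h1 : (k : ℕ) ≠ N) : (derivative (legendre N)).eval (node N k) = 0 := by
  have h := nodePoly_eval_node hN k
  rw [nodePoly, eval_mul] at h
  refine (mul_eq_zero.1 h).resolve_left fun h' => ?_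
  have h2 : (node N k - 1) * (node N k + 1) = 0 := by
    have : node N k ^ 2 - 1 = 0 := by simpa using h'
    linarith
  rcases mul_eq_zero.1 h2 with h | h
  · exact h1 (congrArg Fin.val
      (node_injective hN (show node N k = node N (Fin.last N) by rw [node_last hN]; linarith)))
  · exact h0 (congrArg Fin.val
      (node_injective hN (show node N k = node N 0 by rw [node_zero hN]; linarith)))

/-- The entries of the differentiation matrix are the derivatives of the Lagrange basis at the
nodes. -/
lemma diffMatrix_apply {N : ℕ} (hN : 1 ≤ N) (i k : Fin (N + 1)) :
    diffMatrix N i k = (derivative (nodeBasis N k)).eval (node N i) := by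
  have hne := legendre_eval_node_ne_zero hN k
  rw [diffMatrix]
  split_ifs with h h0 h1
  · have h1 := congrArg (eval (node N i)) (X_sub_C_mul_derivative_nodeBasis hN k)
    simp only [eval_add, eval_mul, eval_sub, eval_X, eval_C, nodeBasis_eval_node hN, if_neg h,
      zero_add] at h1
    have h2 : node N i - node N k ≠ 0 := sub_ne_zero.2 fun h' => h (node_injective hN h')
    field_simp at h1 ⊢
    linarith
  all_goals
    have hik : i = k := not_not.1 h
    subst hik
    have hd := congrArg (fun p => eval (node N i) (derivative p))
      (X_sub_C_mul_derivative_nodeBasis hN i)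
    simp only [derivative_add, derivative_mul, derivative_X_sub_C, derivative_C, eval_add, eval_mul,
      eval_sub, eval_X, eval_C, sub_self, zero_mul, one_mul, add_zero, zero_add] at hd
  · have hi : i = 0 := Fin.ext h0
    have hode := legendre_ode_eval N (-1)
    have hpow : ((-1 : ℝ) ^ N) ≠ 0 := by simp
    rw [hi, node_zero hN, legendre_eval_neg_one] at hd
    rw [legendre_eval_neg_one] at hode
    rw [hi, node_zero hN]
    field_simp at hd
    have hd' : 2 * (derivative (nodeBasis N 0)).eval (-1) * (-1) ^ N =
        (-(N * (N + 1) / 2)) * (-1) ^ N := by linear_combination hd - 1 / 2 * hode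
    have := mul_right_cancel₀ hpow hd'
    linarith
  · have hi : i = Fin.last N := Fin.ext h1
    have hode := legendre_ode_eval N 1
    rw [hi, node_last hN, legendre_eval_one] at hd
    rw [legendre_eval_one] at hode
    rw [hi, node_last hN]
    linarith
  · rw [derivative_legendre_eval_node hN h0 h1] at hd
    linarith

/-- The differentiation matrix is exact on polynomials of degree at most `N`. -/
lemma diffMatrix_mulVec {N : ℕ} (hN : 1 ≤ N) {p : ℝ[X]} (hp : p.natDegree ≤ N) :
    diffMatrix N *ᵥ (fun k => p.eval (node N k)) = fun k => (derivative p).eval (node N k) := by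
  funext i
  conv_rhs => rw [eq_sum_nodeBasis hN hp]
  simp only [Matrix.mulVec, dotProduct, diffMatrix_apply hN, derivative_sum, derivative_C_mul,
    eval_finsetSum, eval_mul, eval_C]
  exact Finset.sum_congr rfl fun k _ => mul_comm _ _

lemma diffMatrix_pow_mulVec {N : ℕ} (hN : 1 ≤ N) {p : ℝ[X]} (hp : p.natDegree ≤ N) (j : ℕ) :
    (diffMatrix N ^ j) *ᵥ (fun k => p.eval (node N k)) =
      fun k => (derivative^[j] p).eval (node N k) := by
  induction j with
  | zero => simp
  | succ j ih =>
    rw [pow_succ', ← Matrix.mulVec_mulVec, ih, diffMatrix_mulVec hN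
      ((natDegree_iterate_derivative _ _).trans ((Nat.sub_le _ _).trans hp)),
      Function.iterate_succ_apply']

/-! ### Legendre-Gauss-Lobatto quadrature -/

lemma nodePoly_dvd_of_eval_node_eq_zero {N : ℕ} (hN : 1 ≤ N) {p : ℝ[X]}
    (h : ∀ k, p.eval (node N k) = 0) : nodePoly N ∣ p := by
  rcases eq_or_ne p 0 with rfl | hp
  · exact dvd_zero _
  have hcard : (nodePoly N).roots.card = (nodePoly N).natDegree :=
    (card_roots' _).antisymm ((natDegree_nodePoly_le hN).trans (card_roots_nodePoly hN))
  rw [← C_leadingCoeff_mul_prod_multiset_X_sub_C hcard]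
  rw [IsUnit.mul_left_dvd]
  swap
  · exact isUnit_C.2 (leadingCoeff_ne_zero.2 (nodePoly_ne_zero hN)).isUnit
  · rw [Multiset.prod_X_sub_C_dvd_iff_le_roots hp,
      Multiset.le_iff_subset (nodup_roots_nodePoly hN)]
    intro t ht
    obtain ⟨k, rfl⟩ := exists_node_eq hN (isRoot_of_mem_roots ht)
    exact (mem_roots hp).2 (h k)

/-- The interpolatory quadrature formula is exact up to degree `2 N - 1`: the interpolation error is
a multiple of `(X² - 1) L_N'`, and integration by parts moves one derivative off `L_N`. -/
lemma quadrature_of_polyInt_nodeBasis {N : ℕ} (hN : 1 ≤ N) {p : ℝ[X]}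
    (hp : p.natDegree ≤ 2 * N - 1) :
    polyInt p = ∑ k, p.eval (node N k) * polyInt (nodeBasis N k) := by
  set r : ℝ[X] := ∑ k, C (p.eval (node N k)) * nodeBasis N k with hr
  have hrdeg : r.natDegree ≤ N := natDegree_sum_le_of_forall_le _ _ fun k _ =>
    (natDegree_C_mul_le _ _).trans (natDegree_nodeBasis_le hN k)
  have hrint : polyInt r = ∑ k, p.eval (node N k) * polyInt (nodeBasis N k) := by
    rw [hr, map_sum]
    simp only [polyInt_C_mul]
  rw [← hrint, ← sub_eq_zero, ← map_sub]
  obtain ⟨s, hs⟩ := nodePoly_dvd_of_eval_node_eq_zero hN (p := p - r) fun i => by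
    simp [hr, eval_finsetSum, nodeBasis_eval_node hN]
  rcases eq_or_ne s 0 with rfl | hs0
  · rw [hs, mul_zero, map_zero]
  have hdeg : (p - r).natDegree ≤ 2 * N - 1 :=
    (natDegree_sub_le _ _).trans (max_le hp (hrdeg.trans (by omega)))
  have hnd : N + 1 ≤ (nodePoly N).natDegree := (card_roots_nodePoly hN).trans (card_roots' _)
  rw [hs, natDegree_mul (nodePoly_ne_zero hN) hs0] at hdeg
  have hX : ((X ^ 2 - 1 : ℝ[X]) * s).natDegree ≤ N := by
    have h : (X ^ 2 - 1 : ℝ[X]).natDegree ≤ 2 := by compute_degree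
    refine natDegree_mul_le.trans ?_
    omega
  rw [hs, nodePoly, mul_comm (X ^ 2 - 1 : ℝ[X]), mul_assoc, polyInt_by_parts,
    polyInt_legendre_mul_eq_zero ((natDegree_derivative_le _).trans_lt (by omega))]
  simp

/-- The LGL weights are the integrals of the Lagrange basis. The proof applies the quadrature
formula to `ℓ_k (ℓ_k - a L_N)`, where `a` is chosen such that the terms of degree `2 N` cancel. -/
lemma polyInt_nodeBasis {N : ℕ} (hN : 1 ≤ N) (k : Fin (N + 1)) :
    polyInt (nodeBasis N k) = weight N k := by
  obtain ⟨n, rfl⟩ : ∃ n, N = n + 1 := ⟨N - 1, by omega⟩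
  have hL := legendre_eval_node_ne_zero hN k
  have hbasis := X_sub_C_mul_nodeBasis hN k
  have hbasis' := X_sub_C_mul_derivative_nodeBasis hN k
  set t := node (n + 1) k with ht
  set L := (legendre (n + 1)).eval t with hLdef
  set l := nodeBasis (n + 1) k with hl
  set a : ℝ := 1 / (((n + 1 : ℕ) + 1) * L) with ha
  set D := l - C a * legendre (n + 1) with hD
  have hn1 : ((n + 1 : ℕ) : ℝ) ≠ 0 := by positivity
  have hn2 : ((n + 1 : ℕ) : ℝ) + 1 ≠ 0 := by positivity
  have hDdeg : D.natDegree < n + 1 := by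
    have h1 : (X - C t) * D = C a * (C t * legendre (n + 1) - legendre n) := by
      rw [hD, mul_sub, hbasis, nodePoly, sq_sub_one_mul_derivative_legendre, ← mul_assoc, ← C_mul]
      rw [show 1 / (((n + 1 : ℕ) : ℝ) * ((n + 1 : ℕ) + 1) * L) * ((n : ℝ) + 1) = a by
        rw [ha]; push_cast; field_simp]
      ring
    rcases eq_or_ne D 0 with h0 | h0
    · simp [h0]
    · have h2 : ((X - C t) * D).natDegree ≤ n + 1 := by
        rw [h1]
        refine (natDegree_C_mul_le _ _).trans ((natDegree_sub_le _ _).trans (max_le ?_ ?_))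
        · exact (natDegree_C_mul_le _ _).trans (natDegree_legendre_le _)
        · exact (natDegree_legendre_le _).trans (by omega)
      rw [natDegree_mul (X_sub_C_ne_zero t) h0, natDegree_X_sub_C] at h2
      omega
  have hquad : polyInt (l * D) = (1 - a * L) * polyInt l := by
    rw [quadrature_of_polyInt_nodeBasis hN (natDegree_mul_le.trans
      (show _ ≤ 2 * (n + 1) - 1 by
        have : l.natDegree ≤ n + 1 := natDegree_nodeBasis_le hN k
        omega))]
    rw [Finset.sum_eq_single k]
    · have h1 : l.eval t = 1 := by rw [hl, ht, nodeBasis_eval_node hN, if_pos rfl]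
      rw [← ht, ← hl, eval_mul, hD, eval_sub, eval_mul, eval_C, h1, one_mul]
    · intro i _ hik
      rw [eval_mul, hl, nodeBasis_eval_node hN, if_neg hik, zero_mul, zero_mul]
    · simp
  have hlL : polyInt (l * legendre (n + 1)) = a * (2 / (2 * (n + 1 : ℕ) + 1)) := by
    have h1 : l * legendre (n + 1) =
        legendre (n + 1) * D + C a * (legendre (n + 1) * legendre (n + 1)) := by rw [hD]; ring
    rw [h1, map_add, polyInt_legendre_mul_eq_zero hDdeg, polyInt_C_mul, polyInt_legendre_mul_self,
      zero_add]
  have hll : polyInt (l * l) = 2 / L * polyInt (l * legendre (n + 1)) := by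
    have h1 := polyInt_by_parts (l * l) (X - C t)
    have hend : ∀ c : ℝ, c ^ 2 = 1 → (l * l).eval c * (X - C t).eval c = 0 := by
      intro c hc
      have h2 := congrArg (eval c) hbasis
      rw [nodePoly, eval_mul, eval_mul, eval_mul] at h2
      simp only [eval_sub, eval_pow, eval_X, eval_one, hc, sub_self, zero_mul, mul_zero, eval_C]
        at h2
      rw [eval_mul, eval_sub, eval_X, eval_C]
      linear_combination l.eval c * h2
    rw [hend 1 (by norm_num), hend (-1) (by norm_num), derivative_X_sub_C, mul_one,
      show derivative (l * l) * (X - C t) =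
        C 2 * (l * (C (1 / L) * legendre (n + 1))) - C 2 * (l * l) by
        rw [← hbasis', derivative_mul, map_ofNat]; ring,
      map_sub, polyInt_C_mul, polyInt_C_mul, mul_left_comm, polyInt_C_mul] at h1
    linear_combination -h1
  have hlD : polyInt (l * D) = polyInt (l * l) - a * polyInt (l * legendre (n + 1)) := by
    rw [← polyInt_C_mul, ← map_sub, hD]
    congr 1
    ring
  have haL : 1 - a * L = (n + 1 : ℕ) / ((n + 1 : ℕ) + 1) := by
    rw [ha]
    field_simp
    ring
  rw [hlD, hll, hlL] at hquad
  refine mul_left_cancel₀ (haL ▸ div_ne_zero hn1 hn2 : 1 - a * L ≠ 0) ?_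
  rw [← hquad, haL, weight, ← ht, ← hLdef, ha]
  have hn3 : (2 * ((n + 1 : ℕ) : ℝ) + 1) ≠ 0 := by positivity
  field_simp
  ring

/-- The quadrature formula is exact on polynomials of degree at most `2 N - 1`. -/
lemma polyInt_eq_sum_weight {N : ℕ} (hN : 1 ≤ N) {p : ℝ[X]} (hp : p.natDegree ≤ 2 * N - 1) :
    polyInt p = ∑ k, p.eval (node N k) * weight N k := by
  simp only [quadrature_of_polyInt_nodeBasis hN hp, polyInt_nodeBasis hN]

/-! ### Weak derivatives and primitives -/

instance isFiniteMeasure_mu : IsFiniteMeasure mu := by unfold mu; infer_instance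

lemma integral_mu_eq (f : ℝ → ℝ) : ∫ t, f t ∂mu = ∫ t in (-1 : ℝ)..1, f t := by
  rw [intervalIntegral.integral_of_le (by norm_num), integral_Ioc_eq_integral_Ioo, mu]

lemma intervalIntegrable_iff_integrable_mu {f : ℝ → ℝ} :
    IntervalIntegrable f volume (-1) 1 ↔ Integrable f mu := by
  rw [intervalIntegrable_iff_integrableOn_Ioo_of_le (by norm_num), mu, IntegrableOn]

lemma mu_eq_restrict_Icc : mu = volume.restrict (Icc (-1) 1) :=
  Measure.restrict_congr_set Ioo_ae_eq_Icc

lemma integrable_mu_of_continuousOn {f : ℝ → ℝ} (hf : ContinuousOn f (Icc (-1) 1)) :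
    Integrable f mu := by
  rw [mu_eq_restrict_Icc]
  exact hf.integrableOn_compact isCompact_Icc

lemma eqOn_Icc_of_ae_eq_mu {f g : ℝ → ℝ} (h : f =ᵐ[mu] g) (hf : ContinuousOn f (Icc (-1) 1))
    (hg : ContinuousOn g (Icc (-1) 1)) : EqOn f g (Icc (-1) 1) := by
  rw [mu_eq_restrict_Icc] at h
  exact Measure.eqOn_Icc_of_ae_eq volume (by norm_num) h hf hg

lemma integrable_mul_test {f φ : ℝ → ℝ} (hf : LocallyIntegrableOn f (Ioo (-1) 1))
    (hφ : Continuous φ) (hc : HasCompactSupport φ) (hs : tsupport φ ⊆ Ioo (-1) 1) :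
    Integrable (fun t => f t * φ t) mu := by
  have h1 : IntegrableOn (fun t => f t * φ t) (tsupport φ) :=
    (hf.integrableOn_compact_subset hs hc).mul_continuousOn hφ.continuousOn hc
  have h2 : Integrable (fun t => f t * φ t) volume := by
    rw [← integrableOn_iff_integrable_of_support_subset (s := tsupport φ)]
    · exact h1
    · exact (Function.support_mul_subset_right _ _).trans (subset_tsupport φ)
  exact h2.restrict

/-- The fundamental lemma of the calculus of variations on `(-1, 1)`. -/
lemma ae_eq_zero_of_test {f : ℝ → ℝ} (hf : LocallyIntegrableOn f (Ioo (-1) 1))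
    (h : ∀ φ : ℝ → ℝ, ContDiff ℝ ∞ φ → HasCompactSupport φ → tsupport φ ⊆ Ioo (-1) 1 →
      ∫ t, f t * φ t ∂mu = 0) : f =ᵐ[mu] 0 := by
  have := isOpen_Ioo.ae_eq_zero_of_integral_contDiff_smul_eq_zero hf fun φ h1 h2 h3 => by
    rw [← h φ h1 h2 h3, mu, setIntegral_eq_integral_of_forall_compl_eq_zero]
    · simp [mul_comm]
    · intro t ht
      rw [image_eq_zero_of_notMem_tsupport fun h => ht (h3 h), mul_zero]
  rw [mu]
  exact (ae_restrict_iff' measurableSet_Ioo).2 this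

lemma HasWeakDeriv.ae_unique {j : ℕ} {ξ v w : ℝ → ℝ} (hv : HasWeakDeriv j ξ v)
    (hw : HasWeakDeriv j ξ w) : v =ᵐ[mu] w := by
  have h := ae_eq_zero_of_test (hv.locInt_deriv.sub hw.locInt_deriv) fun φ h1 h2 h3 => by
    have e := (hv.integral_eq φ h1 h2 h3).symm.trans (hw.integral_eq φ h1 h2 h3)
    have e' := mul_left_cancel₀ (pow_ne_zero j (by norm_num : (-1 : ℝ) ≠ 0)) e
    simp only [Pi.sub_apply, sub_mul]
    rw [integral_sub (integrable_mul_test hv.locInt_deriv h1.continuous h2 h3)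
      (integrable_mul_test hw.locInt_deriv h1.continuous h2 h3), e', sub_self]
  filter_upwards [h] with t ht
  simpa [sub_eq_zero] using ht

lemma hasWeakDeriv_weakDeriv {j : ℕ} {ξ v : ℝ → ℝ} (h : HasWeakDeriv j ξ v) :
    HasWeakDeriv j ξ (weakDeriv j ξ) := by
  have hex : ∃ v, HasWeakDeriv j ξ v := ⟨v, h⟩
  rw [weakDeriv, dif_pos hex]
  exact hex.choose_spec

lemma hasWeakDeriv_zero {ξ : ℝ → ℝ} (h : LocallyIntegrableOn ξ (Ioo (-1) 1)) :
    HasWeakDeriv 0 ξ ξ := ⟨h, h, fun φ _ _ _ => by simp⟩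

/-- The weak derivative of order `j + 1` is the first weak derivative of that of order `j`. -/
lemma HasWeakDeriv.succ {j : ℕ} {ξ v w : ℝ → ℝ} (hv : HasWeakDeriv j ξ v)
    (hw : HasWeakDeriv (j + 1) ξ w) : HasWeakDeriv 1 v w := by
  refine ⟨hv.locInt_deriv, hw.locInt_deriv, fun φ h1 h2 h3 => ?_⟩
  have e1 := hw.integral_eq φ h1 h2 h3
  have e2 := hv.integral_eq (deriv φ) (contDiff_infty_iff_deriv.1 h1).2 h2.deriv
    ((tsupport_deriv_subset).trans h3)
  rw [iteratedDeriv_succ', e2, pow_succ, mul_assoc] at e1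
  rw [iteratedDeriv_one, pow_one]
  exact mul_left_cancel₀ (pow_ne_zero j (by norm_num : (-1 : ℝ) ≠ 0)) e1

/-- `ξ` is, on `[-1, 1]`, a primitive of the integrable function `v`. -/
structure IsPrimitive (ξ v : ℝ → ℝ) : Prop where
  integrable : Integrable v mu
  eq : ∀ t ∈ Icc (-1 : ℝ) 1, ξ t = ξ (-1) + ∫ s in (-1 : ℝ)..t, v s

lemma IsPrimitive.intervalIntegrable {ξ v : ℝ → ℝ} (h : IsPrimitive ξ v) :
    IntervalIntegrable v volume (-1) 1 := intervalIntegrable_iff_integrable_mu.2 h.integrable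

lemma IsPrimitive.congr {ξ ξ' v v' : ℝ → ℝ} (h : IsPrimitive ξ v) (hξ : EqOn ξ ξ' (Icc (-1) 1))
    (hv : v =ᵐ[mu] v') : IsPrimitive ξ' v' := by
  refine ⟨h.integrable.congr hv, fun t ht => ?_⟩
  rw [← hξ ht, ← hξ (by simp), h.eq t ht]
  congr 1
  refine intervalIntegral.integral_congr_ae ?_
  have h1 : ∀ᵐ s ∂volume, s ∈ Icc (-1 : ℝ) 1 → v s = v' s := by
    rw [← ae_restrict_iff' measurableSet_Icc, ← mu_eq_restrict_Icc]
    exact hv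
  filter_upwards [h1] with s hs hst
  rw [uIoc_of_le ht.1] at hst
  exact hs ⟨hst.1.le, hst.2.trans ht.2⟩

/-- An integrable function has the primitive with a given value at `-1`. -/
lemma isPrimitive_integral {v : ℝ → ℝ} (hv : Integrable v mu) (c : ℝ) :
    IsPrimitive (fun t => c + ∫ s in (-1 : ℝ)..t, v s) v :=
  ⟨hv, fun t _ => by simp⟩

lemma absolutelyContinuous_integral {v : ℝ → ℝ} (hv : Integrable v mu) :
    AbsolutelyContinuousOnInterval (fun t => ∫ s in (-1 : ℝ)..t, v s) (-1) 1 :=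
  (intervalIntegrable_iff_integrable_mu.2 hv).absolutelyContinuousOnInterval_intervalIntegral
    left_mem_uIcc

lemma IsPrimitive.continuousOn {ξ v : ℝ → ℝ} (h : IsPrimitive ξ v) :
    ContinuousOn ξ (Icc (-1) 1) := by
  have h1 := (absolutelyContinuous_integral h.integrable).continuousOn
  rw [uIcc_of_le (by norm_num)] at h1
  exact (continuousOn_const.add h1).congr h.eq

/-- Integration by parts for a primitive and a continuously differentiable function. -/
lemma IsPrimitive.integral_mul_deriv {ξ v φ : ℝ → ℝ} (h : IsPrimitive ξ v) (hφ : ContDiff ℝ 1 φ) :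
    ∫ t, ξ t * deriv φ t ∂mu = ξ 1 * φ 1 - ξ (-1) * φ (-1) - ∫ t, v t * φ t ∂mu := by
  have hac := absolutelyContinuous_integral h.integrable
  have hφac : AbsolutelyContinuousOnInterval φ (-1) 1 :=
    hφ.contDiffOn.absolutelyContinuousOnInterval
  have hv := h.intervalIntegrable.ae_hasDerivAt_integral
  have hparts := hac.integral_mul_deriv_eq_deriv_mul hφac
  have hdφ : Continuous (deriv φ) := hφ.continuous_deriv le_rfl
  have hftc : ∫ t in (-1 : ℝ)..1, deriv φ t = φ 1 - φ (-1) :=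
    intervalIntegral.integral_deriv_eq_sub
      (fun t _ => (hφ.differentiable one_ne_zero).differentiableAt) (hdφ.intervalIntegrable _ _)
  have e1 : ∫ t in (-1 : ℝ)..1, ξ t * deriv φ t =
      ∫ t in (-1 : ℝ)..1, (ξ (-1) * deriv φ t + (∫ s in (-1 : ℝ)..t, v s) * deriv φ t) := by
    refine intervalIntegral.integral_congr fun t ht => ?_
    rw [uIcc_of_le (by norm_num)] at ht
    rw [h.eq t ht, add_mul]
  have e2 : ∫ t in (-1 : ℝ)..1, deriv (fun t => ∫ s in (-1 : ℝ)..t, v s) t * φ t =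
      ∫ t in (-1 : ℝ)..1, v t * φ t := by
    refine intervalIntegral.integral_congr_ae ?_
    filter_upwards [hv] with t ht hmem
    rw [(ht (uIoc_subset_uIcc hmem) (-1) left_mem_uIcc).deriv]
  rw [integral_mu_eq, integral_mu_eq, e1, intervalIntegral.integral_add
    ((hdφ.intervalIntegrable _ _).const_mul (ξ (-1)))
    (hdφ.intervalIntegrable _ _ |>.continuousOn_mul hac.continuousOn),
    intervalIntegral.integral_const_mul, hftc, hparts, e2, intervalIntegral.integral_same,
    h.eq 1 (by simp)]
  ring

/-- A compact subset of `(-1, 1)` lies in a compact subinterval. -/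
lemma exists_Icc_of_isCompact {K : Set ℝ} (hK : IsCompact K) (hs : K ⊆ Ioo (-1) 1) :
    ∃ a b : ℝ, -1 < a ∧ a ≤ b ∧ b < 1 ∧ K ⊆ Icc a b := by
  have hK' : IsCompact (insert 0 K) := hK.insert 0
  have hs' : insert 0 K ⊆ Ioo (-1 : ℝ) 1 := insert_subset (by norm_num) hs
  have hne : (insert 0 K).Nonempty := insert_nonempty _ _
  have h1 : ∀ t ∈ insert 0 K, sInf (insert 0 K) ≤ t ∧ t ≤ sSup (insert 0 K) := fun t ht =>
    ⟨csInf_le hK'.bddBelow ht, le_csSup hK'.bddAbove ht⟩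
  have h0 := h1 0 (mem_insert _ _)
  exact ⟨sInf (insert 0 K), sSup (insert 0 K), (hs' (hK'.sInf_mem hne)).1, h0.1.trans h0.2,
    (hs' (hK'.sSup_mem hne)).2, fun t ht => h1 t (mem_insert_of_mem _ ht)⟩

/-- A test function of mean zero is the derivative of a test function. -/
lemma exists_test_primitive {θ : ℝ → ℝ} (h1 : ContDiff ℝ ∞ θ) (h2 : HasCompactSupport θ)
    (h3 : tsupport θ ⊆ Ioo (-1) 1) (h4 : ∫ t, θ t ∂mu = 0) :
    ∃ φ : ℝ → ℝ, ContDiff ℝ ∞ φ ∧ HasCompactSupport φ ∧ tsupport φ ⊆ Ioo (-1) 1 ∧ deriv φ = θ := by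
  obtain ⟨a, b, ha, hab, hb, hK⟩ := exists_Icc_of_isCompact h2 h3
  have hcont := h1.continuous
  set φ : ℝ → ℝ := fun t => ∫ s in (-1 : ℝ)..t, θ s with hφ
  have hder : ∀ t, HasDerivAt φ (θ t) t := fun t =>
    (hcont.integral_hasStrictDerivAt (-1) t).hasDerivAt
  have hd : deriv φ = θ := funext fun t => (hder t).deriv
  have hzero : ∀ s, s ∉ Icc a b → θ s = 0 := fun s hs =>
    image_eq_zero_of_notMem_tsupport fun h => hs (hK h)
  have hsupp : Function.support φ ⊆ Icc a b := by
    intro t ht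
    by_contra hcon
    refine ht ?_
    rcases lt_or_ge t a with h | h
    · refine (intervalIntegral.integral_congr (g := fun _ => 0) fun s hs => ?_).trans (by simp)
      refine hzero s fun hs' => ?_
      have := (mem_uIcc.1 hs)
      rcases this with h' | h' <;> linarith [hs'.1, h'.1, h'.2]
    · have hbt : b < t := not_le.1 fun h' => hcon ⟨h, h'⟩
      rw [integral_mu_eq] at h4
      rw [hφ]
      simp only
      rw [← intervalIntegral.integral_add_adjacent_intervals (hcont.intervalIntegrable _ 1)
        (hcont.intervalIntegrable _ _), h4, zero_add]
      refine (intervalIntegral.integral_congr (g := fun _ => 0) fun s hs => ?_).trans (by simp)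
      refine hzero s fun hs' => ?_
      have := (mem_uIcc.1 hs)
      rcases this with h' | h' <;> linarith [hs'.2, h'.1, h'.2]
  have hts : tsupport φ ⊆ Icc a b := closure_minimal hsupp isClosed_Icc
  refine ⟨φ, contDiff_infty_iff_deriv.2 ⟨fun t => (hder t).differentiableAt, hd ▸ h1⟩,
    isCompact_Icc.of_isClosed_subset (isClosed_tsupport φ) hts,
    hts.trans fun t ht => ⟨ha.trans_le ht.1, ht.2.trans_lt hb⟩, hd⟩

/-- The lemma of du Bois-Reymond: a function with vanishing weak derivative is constant. -/
lemma ae_eq_const_of_test_deriv {w : ℝ → ℝ} (hw : LocallyIntegrableOn w (Ioo (-1) 1))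
    (h : ∀ φ : ℝ → ℝ, ContDiff ℝ ∞ φ → HasCompactSupport φ → tsupport φ ⊆ Ioo (-1) 1 →
      ∫ t, w t * deriv φ t ∂mu = 0) : ∃ c : ℝ, w =ᵐ[mu] fun _ => c := by
  let B : ContDiffBump (0 : ℝ) := ⟨1 / 4, 1 / 2, by norm_num, by norm_num⟩
  set η : ℝ → ℝ := B.normed volume with hη
  have hη1 : ContDiff ℝ ∞ η := B.contDiff_normed
  have hη2 : HasCompactSupport η := B.hasCompactSupport_normed
  have hη3 : tsupport η ⊆ Ioo (-1) 1 := by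
    rw [hη, B.tsupport_normed_eq, Real.closedBall_eq_Icc]
    intro t ht
    simp only [B, mem_Icc] at ht
    constructor <;> linarith [ht.1, ht.2]
  have hη4 : ∫ t, η t ∂mu = 1 := by
    rw [← B.integral_normed (μ := volume), mu, setIntegral_eq_integral_of_forall_compl_eq_zero]
    exact fun t ht => image_eq_zero_of_notMem_tsupport fun h => ht (hη3 h)
  set c := ∫ t, w t * η t ∂mu with hc
  have hconst : LocallyIntegrableOn (fun _ : ℝ => c) (Ioo (-1) 1) :=
    continuous_const.locallyIntegrable.locallyIntegrableOn _
  refine ⟨c, ?_⟩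
  have key := ae_eq_zero_of_test (hw.sub hconst) fun ψ h1 h2 h3 => by
    set I := ∫ t, ψ t ∂mu with hI
    have hψint : Integrable ψ mu := (h1.continuous.integrable_of_hasCompactSupport h2).restrict
    have hηint : Integrable η mu := (hη1.continuous.integrable_of_hasCompactSupport hη2).restrict
    obtain ⟨φ, f1, f2, f3, f4⟩ := exists_test_primitive (θ := fun t => ψ t - I * η t)
      (h1.sub (contDiff_const.mul hη1)) (h2.sub (hη2.mul_left))
      ((tsupport_sub ψ (fun t => I * η t)).trans (union_subset h3
        ((tsupport_mul_subset_right).trans hη3)))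
      (by rw [integral_sub hψint (hηint.const_mul I), integral_const_mul, hη4, mul_one, ← hI,
        sub_self])
    have e := h φ f1 f2 f3
    rw [f4] at e
    have i1 := integrable_mul_test hw h1.continuous h2 h3
    have i2 := integrable_mul_test hw hη1.continuous hη2 hη3
    have e2 : ∫ t, w t * (ψ t - I * η t) ∂mu = ∫ t, w t * ψ t ∂mu - I * c := by
      rw [hc, ← integral_const_mul, ← integral_sub i1 (i2.const_mul I)]
      exact integral_congr_ae (.of_forall fun t => by ring)
    have e3 : ∫ t, (w - fun _ : ℝ => c : ℝ → ℝ) t * ψ t ∂mu = ∫ t, w t * ψ t ∂mu - c * I := by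
      rw [hI, ← integral_const_mul, ← integral_sub i1 (hψint.const_mul c)]
      exact integral_congr_ae (.of_forall fun t => by simp only [Pi.sub_apply]; ring)
    rw [e3]
    linarith
  filter_upwards [key] with t ht
  simpa [sub_eq_zero] using ht

/-- A function with an integrable weak derivative is almost everywhere equal to a primitive. -/
lemma HasWeakDeriv.exists_ae_eq_integral {ξ v : ℝ → ℝ} (h : HasWeakDeriv 1 ξ v)
    (hv : Integrable v mu) : ∃ c : ℝ, ξ =ᵐ[mu] fun t => c + ∫ s in (-1 : ℝ)..t, v s := by
  set W : ℝ → ℝ := fun t => 0 + ∫ s in (-1 : ℝ)..t, v s with hW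
  have hprim : IsPrimitive W v := isPrimitive_integral hv 0
  have hWint : LocallyIntegrableOn W (Ioo (-1) 1) :=
    (show IntegrableOn W (Ioo (-1) 1) volume from
      integrable_mu_of_continuousOn hprim.continuousOn).locallyIntegrableOn
  obtain ⟨c, hc⟩ := ae_eq_const_of_test_deriv (h.locInt.sub hWint) fun φ h1 h2 h3 => by
    have e1 := h.integral_eq φ h1 h2 h3
    have e2 := hprim.integral_mul_deriv (h1.of_le (by norm_cast))
    have z : ∀ c : ℝ, c ∉ Ioo (-1 : ℝ) 1 → φ c = 0 := fun c hc =>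
      image_eq_zero_of_notMem_tsupport fun h => hc (h3 h)
    have hd := (contDiff_infty_iff_deriv.1 h1).2.continuous
    have hds := (tsupport_deriv_subset).trans h3
    rw [z 1 (by simp), z (-1) (by simp)] at e2
    rw [iteratedDeriv_one] at e1
    simp only [Pi.sub_apply, sub_mul]
    rw [integral_sub (integrable_mul_test h.locInt hd h2.deriv hds)
      (integrable_mul_test hWint hd h2.deriv hds), e1, e2]
    ring
  refine ⟨c, ?_⟩
  filter_upwards [hc] with t ht
  simp only [Pi.sub_apply, hW] at ht
  linarith

lemma HasWeakDeriv.isPrimitive {ξ v : ℝ → ℝ} (h : HasWeakDeriv 1 ξ v) (hv : Integrable v mu)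
    (hξ : ContinuousOn ξ (Icc (-1) 1)) : IsPrimitive ξ v := by
  obtain ⟨c, hc⟩ := h.exists_ae_eq_integral hv
  have hp := isPrimitive_integral hv c
  exact hp.congr (eqOn_Icc_of_ae_eq_mu hc hξ hp.continuousOn).symm .rfl

/-- The weak derivatives of a function in `W^{m,∞}`, in the representatives that are primitives of
each other. -/
lemma MemSobolev.exists_primitives {m : ℕ} {ξ : ℝ → ℝ} (h : MemSobolev m ⊤ ξ) :
    ∃ Y : ℕ → ℝ → ℝ, (∀ j < m, IsPrimitive (Y j) (Y (j + 1))) ∧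
      (∀ j ≤ m, HasWeakDeriv j ξ (weakDeriv j ξ) ∧ Y j =ᵐ[mu] weakDeriv j ξ ∧
        MemLp (Y j) ⊤ mu) := by
  have hw : ∀ j ≤ m, HasWeakDeriv j ξ (weakDeriv j ξ) ∧ MemLp (weakDeriv j ξ) ⊤ mu := by
    intro j hj
    obtain ⟨v, hv, hvL⟩ := h j hj
    have := hasWeakDeriv_weakDeriv hv
    exact ⟨this, hvL.ae_eq (hv.ae_unique this)⟩
  have hint : ∀ j ≤ m, Integrable (weakDeriv j ξ) mu := fun j hj =>
    (hw j hj).2.integrable le_top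
  have hex : ∀ j, ∃ Yj : ℝ → ℝ, (j ≤ m → Yj =ᵐ[mu] weakDeriv j ξ) ∧
      (j < m → IsPrimitive Yj (weakDeriv (j + 1) ξ)) := by
    intro j
    rcases lt_or_ge j m with hj | hj
    · obtain ⟨c, hc⟩ := ((hw j hj.le).1.succ (hw (j + 1) hj).1).exists_ae_eq_integral
        (hint (j + 1) hj)
      exact ⟨_, fun _ => hc.symm, fun _ => isPrimitive_integral (hint (j + 1) hj) c⟩
    · exact ⟨weakDeriv j ξ, fun _ => .rfl, fun h => absurd h (by omega)⟩
  choose Y hY1 hY2 using hex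
  refine ⟨Y, fun j hj => (hY2 j hj).congr (fun _ _ => rfl) (hY1 (j + 1) hj).symm,
    fun j hj => ⟨(hw j hj).1, hY1 j hj, (hw j hj).2.ae_eq (hY1 j hj).symm⟩⟩

/-! ### Integrals against functions of bounded variation -/

/-- Integration by parts against a function `w` whose increments are bounded by those of `T`, by
Riemann sums: on a partition into `n` pieces, replacing `w` by a step function costs
`O(1 / n)`, and summation by parts bounds the rest. -/
lemma abs_integral_mul_derivative_le {w T : ℝ → ℝ}
    (hT : ∀ a ∈ Icc (-1 : ℝ) 1, ∀ b ∈ Icc (-1 : ℝ) 1, a ≤ b → |w b - w a| ≤ T b - T a)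
    (hw : Integrable w mu) {z : ℝ[X]} (h1 : z.eval 1 = 0) (h2 : z.eval (-1) = 0) {B : ℝ}
    (hB : ∀ t ∈ Icc (-1 : ℝ) 1, |z.eval t| ≤ B) :
    |∫ t, w t * (derivative z).eval t ∂mu| ≤ B * (T 1 - T (-1)) := by
  set V := T 1 - T (-1) with hV
  obtain ⟨C, hC⟩ := isCompact_Icc.exists_bound_of_continuousOn
    ((derivative z).continuous.continuousOn (s := Icc (-1 : ℝ) 1))
  simp only [Real.norm_eq_abs] at hC
  have key : ∀ n : ℕ, 0 < n →
      |∫ t, w t * (derivative z).eval t ∂mu| ≤ B * V + C * (2 / n) * V := by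
    intro n hn
    have hn' : (0 : ℝ) < n := by exact_mod_cast hn
    set s : ℕ → ℝ := fun i => -1 + 2 / n * i with hs
    have hs0 : s 0 = -1 := by simp [hs]
    have hsn : s n = 1 := by simp only [hs]; field_simp; norm_num
    have hstep : ∀ i, s (i + 1) - s i = 2 / n := fun i => by simp only [hs]; push_cast; ring
    have hle : ∀ i, s i ≤ s (i + 1) := fun i => by
      have := hstep i
      have h3 : (0 : ℝ) < 2 / n := by positivity
      linarith
    have hmono : Monotone s := monotone_nat_of_le_succ hle
    have hmem : ∀ i ≤ n, s i ∈ Icc (-1 : ℝ) 1 := fun i hi =>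
      ⟨hs0 ▸ hmono (Nat.zero_le i), hsn ▸ hmono hi⟩
    have hwi : IntervalIntegrable w volume (-1) 1 := intervalIntegrable_iff_integrable_mu.2 hw
    have hwi' : ∀ i < n, IntervalIntegrable w volume (s i) (s (i + 1)) := fun i hi =>
      hwi.mono_set (by
        rw [uIcc_of_le (hle i), uIcc_of_le (by norm_num)]
        exact Icc_subset_Icc (hmem i hi.le).1 (hmem (i + 1) hi).2)
    have hzc : Continuous fun t => (derivative z).eval t := (derivative z).continuous
    have hpiece : ∀ i < n, ∫ t in s i..s (i + 1), w t * (derivative z).eval t =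
        w (s i) * (z.eval (s (i + 1)) - z.eval (s i)) +
          ∫ t in s i..s (i + 1), (w t - w (s i)) * (derivative z).eval t := by
      intro i hi
      have hint1 : IntervalIntegrable (fun t => w t * (derivative z).eval t) volume
        (s i) (s (i + 1)) := (hwi' i hi).mul_continuousOn hzc.continuousOn
      have hint2 : IntervalIntegrable (fun t => w (s i) * (derivative z).eval t) volume
        (s i) (s (i + 1)) := (hzc.intervalIntegrable _ _).const_mul _
      rw [← intervalIntegral.integral_eq_sub_of_hasDerivAt (fun t _ => z.hasDerivAt t)
        (hzc.intervalIntegrable _ _), ← intervalIntegral.integral_const_mul, ← sub_eq_iff_eq_add',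
        ← intervalIntegral.integral_sub hint1 hint2]
      exact intervalIntegral.integral_congr fun t _ => by ring
    have herr : ∀ i < n, |∫ t in s i..s (i + 1), (w t - w (s i)) * (derivative z).eval t| ≤
        C * (2 / n) * (T (s (i + 1)) - T (s i)) := by
      intro i hi
      have := intervalIntegral.norm_integral_le_of_norm_le_const (a := s i) (b := s (i + 1))
        (f := fun t => (w t - w (s i)) * (derivative z).eval t)
        (C := (T (s (i + 1)) - T (s i)) * C) fun t ht => by
          rw [uIoc_of_le (hle i)] at ht
          have hti : t ∈ Icc (-1 : ℝ) 1 :=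
            ⟨(hmem i hi.le).1.trans ht.1.le, ht.2.trans (hmem (i + 1) hi).2⟩
          have e1 := hT _ (hmem i hi.le) _ hti ht.1.le
          have e2 := (abs_nonneg _).trans (hT _ hti _ (hmem (i + 1) hi) ht.2)
          rw [norm_mul, Real.norm_eq_abs, Real.norm_eq_abs]
          exact mul_le_mul (by linarith) (hC t hti) (abs_nonneg _)
            (by linarith [abs_nonneg (w t - w (s i))])
      rw [Real.norm_eq_abs, hstep, abs_of_pos (by positivity : (0 : ℝ) < 2 / n)] at this
      linarith
    have htel : ∑ i ∈ Finset.range n, (T (s (i + 1)) - T (s i)) = V := by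
      rw [Finset.sum_range_sub (fun i => T (s i)), hs0, hsn]
    have habel : ∑ i ∈ Finset.range n, w (s i) * (z.eval (s (i + 1)) - z.eval (s i)) =
        -∑ i ∈ Finset.range n, z.eval (s (i + 1)) * (w (s (i + 1)) - w (s i)) := by
      have := Finset.sum_range_sub (fun i => w (s i) * z.eval (s i)) n
      rw [hs0, hsn, h1, h2, mul_zero, mul_zero, sub_zero] at this
      rw [eq_neg_iff_add_eq_zero, ← Finset.sum_add_distrib, ← this]
      exact Finset.sum_congr rfl fun i _ => by ring
    have hB0 : 0 ≤ B := (abs_nonneg _).trans (hB 1 (by simp))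
    rw [integral_mu_eq, ← hs0, ← hsn, ← intervalIntegral.sum_integral_adjacent_intervals
      (fun i hi => (hwi' i hi).mul_continuousOn hzc.continuousOn),
      Finset.sum_congr rfl fun i hi => hpiece i (Finset.mem_range.1 hi), Finset.sum_add_distrib,
      habel]
    refine (abs_add_le _ _).trans (add_le_add ?_ ?_)
    · rw [abs_neg, ← htel, Finset.mul_sum]
      refine (Finset.abs_sum_le_sum_abs _ _).trans (Finset.sum_le_sum fun i hi => ?_)
      have hi := Finset.mem_range.1 hi
      rw [abs_mul]
      exact mul_le_mul (hB _ (hmem (i + 1) hi)) (hT _ (hmem i hi.le) _ (hmem (i + 1) hi) (hle i))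
        (abs_nonneg _) hB0
    · rw [← htel, Finset.mul_sum]
      exact (Finset.abs_sum_le_sum_abs _ _).trans (Finset.sum_le_sum fun i hi =>
        herr i (Finset.mem_range.1 hi))
  have hlim : Filter.Tendsto (fun n : ℕ => B * V + C * (2 / (n : ℝ)) * V) Filter.atTop
      (nhds (B * V + C * 0 * V)) :=
    ((tendsto_const_div_atTop_nhds_zero_nat 2).const_mul C |>.mul_const V).const_add _
  rw [mul_zero, zero_mul, add_zero] at hlim
  refine ge_of_tendsto hlim ?_
  filter_upwards [Filter.eventually_gt_atTop 0] with n hn using key n hn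

lemma abs_integral_mul_derivative_le_totalVariation {η : ℝ → ℝ} (hη : Integrable η mu)
    (hV : essVariation η ≠ ⊤) {z : ℝ[X]} (h1 : z.eval 1 = 0) (h2 : z.eval (-1) = 0) {B : ℝ}
    (hB : ∀ t ∈ Icc (-1 : ℝ) 1, |z.eval t| ≤ B) :
    |∫ t, η t * (derivative z).eval t ∂mu| ≤ B * totalVariation η := by
  have hB0 : 0 ≤ B := (abs_nonneg _).trans (hB 1 (by simp))
  have key : ∀ w : ℝ → ℝ, w =ᵐ[mu] η → eVariationOn w (Icc (-1) 1) ≠ ⊤ →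
      |∫ t, η t * (derivative z).eval t ∂mu| ≤ B * (eVariationOn w (Icc (-1) 1)).toReal := by
    intro w hw hfin
    have hbv : BoundedVariationOn w (Icc (-1) 1) := hfin
    have hl := hbv.locallyBoundedVariationOn
    have h := abs_integral_mul_derivative_le (w := w)
      (T := variationOnFromTo w (Icc (-1) 1) (-1)) (fun a ha b hb hab =>
        variationOnFromTo.abs_sub_le_sub_of_le hl (by simp) ha hb hab)
      (hη.congr hw.symm) h1 h2 hB
    rw [variationOnFromTo.self, sub_zero, variationOnFromTo.eq_of_le _ _ (by norm_num),
      inter_self] at h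
    rwa [integral_congr_ae (g := fun t => w t * (derivative z).eval t)]
    filter_upwards [hw] with t ht
    rw [ht]
  refine le_of_forall_pos_le_add fun ε hε => ?_
  have hlt : essVariation η < essVariation η + ENNReal.ofReal (ε / (B + 1)) :=
    ENNReal.lt_add_right hV (by simp; positivity)
  nth_rewrite 1 [essVariation] at hlt
  simp only [iInf_lt_iff] at hlt
  obtain ⟨w, hw, hlt⟩ := hlt
  have hfin := hlt.trans (ENNReal.add_lt_top.2 ⟨hV.lt_top, ENNReal.ofReal_lt_top⟩)
  refine (key w hw hfin.ne).trans ?_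
  have h3 := ENNReal.toReal_mono (by finiteness) hlt.le
  rw [ENNReal.toReal_add hV ENNReal.ofReal_ne_top, ENNReal.toReal_ofReal (by positivity)] at h3
  calc _ ≤ B * (totalVariation η + ε / (B + 1)) := mul_le_mul_of_nonneg_left h3 hB0
    _ = B * totalVariation η + B / (B + 1) * ε := by ring
    _ ≤ B * totalVariation η + 1 * ε := by
      gcongr
      rw [div_le_one (by positivity)]; linarith
    _ = _ := by rw [one_mul]

/-- A primitive of an integrable function has bounded variation. -/
lemma IsPrimitive.essVariation_ne_top {ξ v : ℝ → ℝ} (h : IsPrimitive ξ v) :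
    essVariation ξ ≠ ⊤ := by
  have hle : essVariation ξ ≤ eVariationOn ξ (Icc (-1) 1) := by
    rw [essVariation]
    exact iInf_le_of_le ξ (iInf_le_of_le (ae_eq_refl ξ) le_rfl)
  refine ne_top_of_le_ne_top ?_ hle
  have hac := (absolutelyContinuous_integral h.integrable).boundedVariationOn
  rw [uIcc_of_le (by norm_num)] at hac
  have hlip : LipschitzWith 1 fun s : ℝ => ξ (-1) + s := (isometry_add_left _).lipschitz
  have hbv := hlip.comp_boundedVariationOn hac
  rw [eVariationOn.eq_of_eqOn h.eq]
  exact hbv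

/-! ### Legendre coefficients -/

/-- The inner product `∫ ξ L_n` of `ξ` with the Legendre polynomial `L_n`. -/
def legInner (n : ℕ) (ξ : ℝ → ℝ) : ℝ := ∫ t, ξ t * (legendre n).eval t ∂mu

lemma integrable_mul_eval {η : ℝ → ℝ} (hη : Integrable η mu) (p : ℝ[X]) :
    Integrable (fun t => η t * p.eval t) mu := by
  rw [← intervalIntegrable_iff_integrable_mu] at hη ⊢
  exact hη.mul_continuousOn p.continuous.continuousOn

lemma abs_legInner_le {η : ℝ → ℝ} (hη : Integrable η mu) (hV : essVariation η ≠ ⊤) {n : ℕ}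
    (hn : 1 ≤ n) : |legInner n η| ≤ totalVariation η / (√n * (n + 1)) := by
  have hn' : (0 : ℝ) < n := by exact_mod_cast hn
  set lam : ℝ := n * (n + 1)
  have hlam : 0 < lam := by positivity
  have hd : derivative (C (1 / lam) * nodePoly n) = legendre n := by
    rw [derivative_C_mul, derivative_nodePoly, ← mul_assoc, ← C_mul, one_div,
      inv_mul_cancel₀ hlam.ne', C_1, one_mul]
  have h := abs_integral_mul_derivative_le_totalVariation hη hV (z := C (1 / lam) * nodePoly n)
    (B := 1 / lam * √n) (by simp [nodePoly]) (by simp [nodePoly]) fun t ht => by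
      rw [eval_mul, eval_C, abs_mul, abs_of_pos (by positivity)]
      refine mul_le_mul_of_nonneg_left (Real.abs_le_sqrt ?_) (by positivity)
      have := sq_one_sub_sq_mul_derivative_legendre_le n ht
      simpa [nodePoly] using this
  rw [hd] at h
  refine h.trans (le_of_eq ?_)
  have hsq : √(n : ℝ) ^ 2 = n := Real.sq_sqrt hn'.le
  have hs0 : √(n : ℝ) ≠ 0 := (Real.sqrt_pos.2 hn').ne'
  simp only [lam]
  field_simp
  rw [hsq]

/-- Integration by parts relates the coefficients of a function to those of its derivative. -/
lemma IsPrimitive.legInner_succ {ξ v : ℝ → ℝ} (h : IsPrimitive ξ v) (n : ℕ) :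
    (2 * (n : ℝ) + 3) * legInner (n + 1) ξ = legInner n v - legInner (n + 2) v := by
  have hp := h.integral_mul_deriv (φ := fun t => (legendre (n + 2) - legendre n).eval t)
    (by
      simpa [coe_aeval_eq_eval] using (legendre (n + 2) - legendre n).contDiff_aeval (𝕜 := ℝ) 1)
  have hd : ∀ t, deriv (fun t => (legendre (n + 2) - legendre n).eval t) t =
      (2 * (n : ℝ) + 3) * (legendre (n + 1)).eval t := fun t => by
    rw [Polynomial.deriv, derivative_sub, derivative_legendre_add_two, add_sub_cancel_left,
      eval_mul, eval_C]
  have e1 : ∫ t, ξ t * deriv (fun t => (legendre (n + 2) - legendre n).eval t) t ∂mu =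
      (2 * (n : ℝ) + 3) * legInner (n + 1) ξ := by
    rw [legInner, ← integral_const_mul]
    exact integral_congr_ae (.of_forall fun t => by simp only [hd]; ring)
  have e2 : ∫ t, v t * (legendre (n + 2) - legendre n).eval t ∂mu =
      legInner (n + 2) v - legInner n v := by
    rw [legInner, legInner, ← integral_sub (integrable_mul_eval h.integrable _)
      (integrable_mul_eval h.integrable _)]
    exact integral_congr_ae (.of_forall fun t => by simp only [eval_sub]; ring)
  rw [e1, e2] at hp
  simp only [eval_sub, legendre_eval_one, legendre_eval_neg_one, pow_add] at hp
  norm_num at hp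
  linarith

lemma abs_legInner_zero_le {η : ℝ → ℝ} (hη : MemLp η ⊤ mu) :
    |legInner 0 η| ≤ 2 * supBound η := by
  have hfin : eLpNorm η ⊤ mu ≠ ⊤ := hη.eLpNorm_ne_top
  have h1 : ∀ᵐ t ∂mu, ‖η t * (legendre 0).eval t‖ ≤ supBound η := by
    rw [eLpNorm_exponent_top] at hfin
    filter_upwards [ae_le_eLpNormEssSup (f := η) (μ := mu)] with t ht
    rw [legendre_zero, eval_one, mul_one, supBound, eLpNorm_exponent_top]
    have := ENNReal.toReal_mono hfin ht
    simpa using this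
  have h2 := norm_integral_le_of_norm_le_const h1
  have h3 : mu.real univ = 2 := by
    simp [mu, Measure.real]; norm_num
  rw [h3, Real.norm_eq_abs] at h2
  rw [legInner]
  linarith

lemma rpow_three_halves {n : ℕ} (hn : 1 ≤ n) : (n : ℝ) ^ (3 / 2 : ℝ) = n * √n := by
  have hn' : (0 : ℝ) < n := by exact_mod_cast hn
  rw [show (3 / 2 : ℝ) = 1 + 1 / 2 by norm_num, Real.rpow_add hn', Real.rpow_one,
    Real.sqrt_eq_rpow]

/-- The bound for the Legendre coefficients of a function whose derivative `v` is bounded and of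
bounded variation. -/
lemma IsPrimitive.abs_coeff_le {ξ v : ℝ → ℝ} (h : IsPrimitive ξ v) (hv : MemLp v ⊤ mu)
    (hV : essVariation v ≠ ⊤) {n : ℕ} (hn : 1 ≤ n) :
    |((n : ℝ) + 1 / 2) * legInner n ξ| ≤
      6 * (supBound v + totalVariation v) / (√Real.pi * (n : ℝ) ^ (3 / 2 : ℝ)) := by
  obtain ⟨k, rfl⟩ : ∃ k, n = k + 1 := ⟨n - 1, by omega⟩
  have hU0 : 0 ≤ supBound v := ENNReal.toReal_nonneg
  have hV0 : 0 ≤ totalVariation v := ENNReal.toReal_nonneg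
  have hk : (0 : ℝ) ≤ k := k.cast_nonneg
  set Q := ((k + 1 : ℕ) : ℝ) ^ (3 / 2 : ℝ) with hQ
  have hQ' : Q = (k + 1) * √((k : ℝ) + 1) := by
    rw [hQ, rpow_three_halves hn]; push_cast; rfl
  have hQpos : 0 < Q := by positivity
  have hpi : √Real.pi ≤ 2 := by
    rw [Real.sqrt_le_left (by norm_num)]
    linarith [Real.pi_le_four]
  have hpi0 : 0 < √Real.pi := Real.sqrt_pos.2 Real.pi_pos
  have hrhs : 3 * (supBound v + totalVariation v) / Q ≤
      6 * (supBound v + totalVariation v) / (√Real.pi * Q) := by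
    rw [div_le_div_iff₀ hQpos (by positivity)]
    have : 0 ≤ (supBound v + totalVariation v) * Q := by positivity
    nlinarith
  refine le_trans ?_ hrhs
  have e : (((k + 1 : ℕ) : ℝ) + 1 / 2) * legInner (k + 1) ξ =
      1 / 2 * (legInner k v - legInner (k + 2) v) := by
    rw [← h.legInner_succ]; push_cast; ring
  have h2 : |legInner (k + 2) v| ≤ totalVariation v / Q := by
    refine (abs_legInner_le h.integrable hV (by omega)).trans ?_
    refine div_le_div_of_nonneg_left hV0 hQpos ?_
    rw [hQ', mul_comm]
    push_cast
    exact mul_le_mul (Real.sqrt_le_sqrt (by linarith)) (by linarith) (by positivity) (by positivity)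
  have h1 : |legInner k v| ≤ 2 * (supBound v + totalVariation v) / Q := by
    rcases k.eq_zero_or_pos with rfl | hk1
    · have := abs_legInner_zero_le hv
      simp [hQ]
      linarith
    · refine (abs_legInner_le h.integrable hV hk1).trans ?_
      have hk1' : (1 : ℝ) ≤ k := by exact_mod_cast hk1
      have hs : √((k : ℝ) + 1) ≤ 2 * √(k : ℝ) := by
        rw [Real.sqrt_le_left (by positivity), mul_pow, Real.sq_sqrt hk]
        linarith
      rw [div_le_div_iff₀ (by positivity) hQpos, hQ']
      calc totalVariation v * ((k + 1) * √((k : ℝ) + 1))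
          ≤ (supBound v + totalVariation v) * ((k + 1) * (2 * √(k : ℝ))) := by
            gcongr; linarith
        _ = _ := by ring
  rw [e, abs_mul, abs_of_pos (by norm_num : (0 : ℝ) < 1 / 2)]
  have h3 := abs_sub (legInner k v) (legInner (k + 2) v)
  have h4 : totalVariation v / Q ≤ (supBound v + totalVariation v) / Q := by
    gcongr; linarith
  have h5 : 0 ≤ (supBound v + totalVariation v) / Q := by positivity
  rw [mul_div_assoc] at h1 ⊢
  linarith

/-! ### Convergence of the Legendre series -/

/-- A decay rate of the Legendre coefficients of the derivative improves by one power for the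
function itself. -/
lemma IsPrimitive.legInner_decay {ξ v : ℝ → ℝ} (h : IsPrimitive ξ v) {p : ℝ} (hp : 0 ≤ p)
    (hv : ∃ C, ∀ n : ℕ, 1 ≤ n → |legInner n v| ≤ C * (n : ℝ) ^ (-p)) :
    ∃ C, ∀ n : ℕ, 1 ≤ n → |legInner n ξ| ≤ C * (n : ℝ) ^ (-(p + 1)) := by
  obtain ⟨C, hC⟩ := hv
  have hC0 : 0 ≤ C := by simpa using (abs_nonneg _).trans (hC 1 le_rfl)
  refine ⟨max |legInner 1 ξ| (C * (2 : ℝ) ^ p + C), fun n hn => ?_⟩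
  obtain ⟨k, rfl⟩ : ∃ k, n = k + 1 := ⟨n - 1, by omega⟩
  rcases k.eq_zero_or_pos with rfl | hk
  · simp
  refine le_trans ?_ (mul_le_mul_of_nonneg_right (le_max_right _ _) (by positivity))
  have hk' : (1 : ℝ) ≤ k := by exact_mod_cast hk
  set q : ℝ := ((k + 1 : ℕ) : ℝ) with hq
  have hqk : q = k + 1 := by rw [hq]; push_cast; ring
  have hq0 : 0 < q := by linarith
  have h1 : |legInner k v| ≤ C * (2 : ℝ) ^ p * q ^ (-p) := by
    refine (hC k hk).trans ?_
    rw [mul_assoc]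
    refine mul_le_mul_of_nonneg_left ?_ hC0
    have hhalf : (k : ℝ) ^ (-p) ≤ (q / 2) ^ (-p) :=
      Real.rpow_le_rpow_of_nonpos (by positivity) (by linarith) (by linarith)
    refine hhalf.trans (le_of_eq ?_)
    rw [Real.div_rpow hq0.le (by norm_num), Real.rpow_neg (by norm_num : (0 : ℝ) ≤ 2)]
    field_simp
  have h2 : |legInner (k + 2) v| ≤ C * q ^ (-p) := by
    refine (hC (k + 2) (by omega)).trans (mul_le_mul_of_nonneg_left ?_ hC0)
    refine Real.rpow_le_rpow_of_nonpos hq0 ?_ (by linarith)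
    push_cast; linarith
  have h3 := h.legInner_succ k
  have h4 : q * |legInner (k + 1) ξ| ≤ (2 * (k : ℝ) + 3) * |legInner (k + 1) ξ| :=
    mul_le_mul_of_nonneg_right (by linarith) (abs_nonneg _)
  have h5 : (2 * (k : ℝ) + 3) * |legInner (k + 1) ξ| = |legInner k v - legInner (k + 2) v| := by
    rw [← h3, abs_mul, abs_of_pos (by positivity : (0 : ℝ) < 2 * (k : ℝ) + 3)]
  have h6 := abs_sub (legInner k v) (legInner (k + 2) v)
  have h7 : q ^ (-(p + 1)) = q ^ (-p) / q := by
    rw [neg_add, ← sub_eq_add_neg, Real.rpow_sub hq0, Real.rpow_one]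
  rw [h7, mul_div_assoc', le_div_iff₀ hq0]
  linarith

/-- A continuous function that is orthogonal to all Legendre polynomials vanishes. -/
lemma eqOn_zero_of_legInner_eq_zero {δ : ℝ → ℝ} (hδ : ContinuousOn δ (Icc (-1) 1))
    (h : ∀ n, legInner n δ = 0) : EqOn δ 0 (Icc (-1) 1) := by
  have hint := integrable_mu_of_continuousOn hδ
  have hpoly : ∀ p : ℝ[X], ∫ t, δ t * p.eval t ∂mu = 0 := by
    intro p
    have hp : p ∈ Submodule.span ℝ (Set.range legendre) := by
      rw [span_range_legendre]; exact Submodule.mem_top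
    induction hp using Submodule.span_induction with
    | mem p hp =>
      obtain ⟨n, rfl⟩ := hp
      exact h n
    | zero => simp
    | add p q _ _ hp hq =>
      simp only [eval_add, mul_add]
      rw [integral_add (integrable_mul_eval hint p) (integrable_mul_eval hint q), hp, hq, add_zero]
    | smul c p _ hp =>
      simp only [eval_smul, smul_eq_mul, mul_left_comm]
      rw [integral_const_mul, hp, mul_zero]
  have hsq : ContinuousOn (fun t => δ t * δ t) (Icc (-1) 1) := hδ.mul hδ
  have hsqint := integrable_mu_of_continuousOn hsq
  have hle : ∫ t, δ t * δ t ∂mu ≤ 0 := by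
    refine le_of_forall_pos_le_add fun ε hε => ?_
    set A := ∫ t, |δ t| ∂mu with hA
    have hA0 : 0 ≤ A := integral_nonneg fun t => abs_nonneg _
    obtain ⟨p, hp⟩ := exists_polynomial_near_of_continuousOn (-1) 1 δ hδ (ε / (A + 1))
      (by positivity)
    have e : ∫ t, δ t * δ t ∂mu = ∫ t, (δ t * δ t - δ t * p.eval t) ∂mu := by
      rw [integral_sub hsqint (integrable_mul_eval hint p), hpoly, sub_zero]
    rw [e, zero_add]
    calc ∫ t, (δ t * δ t - δ t * p.eval t) ∂mu ≤ ∫ t, ε / (A + 1) * |δ t| ∂mu := by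
          refine integral_mono_ae (hsqint.sub (integrable_mul_eval hint p))
            (hint.abs.const_mul _) ?_
          rw [mu]
          filter_upwards [ae_restrict_mem measurableSet_Ioo] with t ht
          have h1 := (hp t ⟨ht.1.le, ht.2.le⟩).le
          calc δ t * δ t - δ t * p.eval t ≤ |δ t * (δ t - p.eval t)| := by
                rw [mul_sub]; exact le_abs_self _
            _ = |p.eval t - δ t| * |δ t| := by rw [abs_mul, abs_sub_comm, mul_comm]
            _ ≤ _ := mul_le_mul_of_nonneg_right h1 (abs_nonneg _)
      _ = A / (A + 1) * ε := by rw [integral_const_mul, ← hA]; ring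
      _ ≤ 1 * ε := by
        gcongr
        rw [div_le_one (by positivity)]; linarith
      _ = ε := one_mul ε
  have hae : (fun t => δ t * δ t) =ᵐ[mu] 0 :=
    (integral_eq_zero_iff_of_nonneg (fun t => mul_self_nonneg _) hsqint).1
      (hle.antisymm (integral_nonneg fun t => mul_self_nonneg _))
  refine eqOn_Icc_of_ae_eq_mu ?_ hδ continuousOn_const
  filter_upwards [hae] with t ht
  simpa using ht

/-- The coefficient of `L_n` in the Legendre expansion of `ξ`. -/
def legCoeff (n : ℕ) (ξ : ℝ → ℝ) : ℝ := ((n : ℝ) + 1 / 2) * legInner n ξ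

/-- A continuous function with absolutely summable Legendre coefficients is the sum of its Legendre
series. -/
lemma hasSum_legendre {ξ : ℝ → ℝ} (hξ : ContinuousOn ξ (Icc (-1) 1))
    (hs : Summable fun n => |legCoeff n ξ|) {t : ℝ} (ht : t ∈ Icc (-1 : ℝ) 1) :
    HasSum (fun n => legCoeff n ξ * (legendre n).eval t) (ξ t) := by
  have hbound : ∀ n, ∀ t ∈ Icc (-1 : ℝ) 1,
      ‖legCoeff n ξ * (legendre n).eval t‖ ≤ |legCoeff n ξ| := by
    intro n t ht
    rw [norm_mul, Real.norm_eq_abs, Real.norm_eq_abs]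
    exact mul_le_of_le_one_right (abs_nonneg _) (abs_legendre_le_one n ht)
  have hsum : ∀ t ∈ Icc (-1 : ℝ) 1, Summable fun n => legCoeff n ξ * (legendre n).eval t :=
    fun t ht => hs.of_norm_bounded fun n => hbound n t ht
  set S : ℝ → ℝ := fun t => ∑' n, legCoeff n ξ * (legendre n).eval t with hS
  have hScont : ContinuousOn S (Icc (-1) 1) :=
    continuousOn_tsum (fun n => (continuous_const.mul (legendre n).continuous).continuousOn) hs
      fun n t ht => hbound n t ht
  have hSint := integrable_mu_of_continuousOn hScont
  have hξint := integrable_mu_of_continuousOn hξ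
  have hinner : ∀ k, legInner k S = legInner k ξ := by
    intro k
    have hF : ∀ n, Integrable
        (fun t => legCoeff n ξ * ((legendre n * legendre k).eval t)) mu := fun n =>
      integrable_mu_of_continuousOn
        (continuous_const.mul (legendre n * legendre k).continuous).continuousOn
    have hFle : ∀ n, ∫ t, ‖legCoeff n ξ * ((legendre n * legendre k).eval t)‖ ∂mu ≤
        2 * |legCoeff n ξ| := by
      intro n
      have h3 : mu.real univ = 2 := by
        simp [mu, Measure.real]; norm_num
      have h2 : ∫ _ : ℝ, |legCoeff n ξ| ∂mu = 2 * |legCoeff n ξ| := by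
        rw [integral_const, h3, smul_eq_mul]
      rw [← h2]
      refine integral_mono_ae (hF n).norm (integrable_const _) ?_
      rw [mu]
      filter_upwards [ae_restrict_mem measurableSet_Ioo] with t ht
      have ht' : t ∈ Icc (-1 : ℝ) 1 := ⟨ht.1.le, ht.2.le⟩
      rw [eval_mul, ← mul_assoc, norm_mul]
      exact (mul_le_of_le_one_right (norm_nonneg _) (abs_legendre_le_one k ht')).trans
        (hbound n t ht')
    have h1 := hasSum_integral_of_summable_integral_norm hF
      (Summable.of_nonneg_of_le (fun n => integral_nonneg fun t => norm_nonneg _) hFle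
        (hs.mul_left 2))
    have h2 : ∀ n, ∫ t, legCoeff n ξ * ((legendre n * legendre k).eval t) ∂mu =
        if n = k then legInner k ξ else 0 := by
      intro n
      rw [integral_const_mul, integral_mu_eq, ← polyInt_apply]
      split_ifs with hnk
      · subst hnk
        rw [polyInt_legendre_mul_self, legCoeff]
        field_simp
      · rw [polyInt_legendre_mul_legendre hnk, mul_zero]
    simp only [h2] at h1
    have h3 := h1.unique (hasSum_ite_eq k (legInner k ξ))
    rw [← h3, legInner]
    refine integral_congr_ae ?_
    rw [mu]
    filter_upwards [ae_restrict_mem measurableSet_Ioo] with t ht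
    rw [hS]
    simp only
    rw [← tsum_mul_right]
    exact tsum_congr fun n => by rw [eval_mul, mul_assoc]
  have hzero := eqOn_zero_of_legInner_eq_zero (hξ.sub hScont) fun k => by
    have h1 : legInner k (ξ - S) = legInner k ξ - legInner k S := by
      rw [legInner, legInner, legInner, ← integral_sub (integrable_mul_eval hξint _)
        (integrable_mul_eval hSint _)]
      exact integral_congr_ae (.of_forall fun t => by simp only [Pi.sub_apply]; ring)
    rwa [hinner, sub_self] at h1
  have hξS : ξ t = S t := by
    have := hzero ht
    simpa [sub_eq_zero] using this
  rw [hξS]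
  exact (hsum t ht).hasSum

/-- The Legendre expansion of `ξ`, truncated at degree `K`. -/
def legTrunc (K : ℕ) (ξ : ℝ → ℝ) : ℝ[X] :=
  ∑ n ∈ Finset.range (K + 1), C (legCoeff n ξ) * legendre n

lemma natDegree_legTrunc_le (K : ℕ) (ξ : ℝ → ℝ) : (legTrunc K ξ).natDegree ≤ K :=
  natDegree_sum_le_of_forall_le _ _ fun n hn => (natDegree_C_mul_le _ _).trans
    ((natDegree_legendre_le n).trans (Nat.lt_succ_iff.1 (Finset.mem_range.1 hn)))

lemma polyInt_legendre_mul_legTrunc (n K : ℕ) (ξ : ℝ → ℝ) :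
    polyInt (legendre n * legTrunc K ξ) = if n ≤ K then legInner n ξ else 0 := by
  have h1 : ∀ k, polyInt (legendre n * (C (legCoeff k ξ) * legendre k)) =
      if n = k then legInner n ξ else 0 := by
    intro k
    rw [mul_left_comm, polyInt_C_mul]
    split_ifs with h
    · subst h
      rw [polyInt_legendre_mul_self, legCoeff]
      field_simp
    · rw [polyInt_legendre_mul_legendre h, mul_zero]
  rw [legTrunc, Finset.mul_sum, map_sum]
  simp only [h1, Finset.sum_ite_eq, Finset.mem_range, Nat.lt_succ_iff]

/-- If the coefficients of the Legendre series are `O(n^{-(q + 5/4)})`, the error of its truncation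
is `O(K^{-q})`, because `n^{-(q + 5/4)} ≤ K^{-q} n^{-5/4}` for `n > K`. -/
lemma abs_legTrunc_sub_le {ξ : ℝ → ℝ} (hξ : ContinuousOn ξ (Icc (-1) 1)) {q : ℝ} (hq : 0 ≤ q)
    (h : ∃ C, ∀ n : ℕ, 1 ≤ n → |legCoeff n ξ| ≤ C * (n : ℝ) ^ (-(q + 5 / 4))) :
    ∃ C, 0 ≤ C ∧ ∀ K : ℕ, 1 ≤ K → ∀ t ∈ Icc (-1 : ℝ) 1,
      |(legTrunc K ξ).eval t - ξ t| ≤ C * (K : ℝ) ^ (-q) := by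
  obtain ⟨C, hC⟩ := h
  have hC0 : 0 ≤ C := by simpa using (abs_nonneg _).trans (hC 1 le_rfl)
  set g : ℕ → ℝ := fun n => (n : ℝ) ^ (-(5 / 4 : ℝ)) with hg
  have hgs : Summable g := Real.summable_nat_rpow.2 (by norm_num)
  have hg0 : ∀ n, 0 ≤ g n := fun n => Real.rpow_nonneg n.cast_nonneg _
  have hle : ∀ K n : ℕ, 1 ≤ K → K ≤ n → |legCoeff n ξ| ≤ C * (K : ℝ) ^ (-q) * g n := by
    intro K n hK hKn
    have hn0 : (0 : ℝ) < n := by exact_mod_cast (by omega : 0 < n)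
    have hK0 : (0 : ℝ) < K := by exact_mod_cast hK
    refine (hC n (hK.trans hKn)).trans ?_
    rw [neg_add, Real.rpow_add hn0, ← mul_assoc]
    refine mul_le_mul_of_nonneg_right (mul_le_mul_of_nonneg_left ?_ hC0) (hg0 n)
    exact Real.rpow_le_rpow_of_nonpos hK0 (by exact_mod_cast hKn) (by linarith)
  have hs : Summable fun n => |legCoeff n ξ| := by
    rw [← summable_nat_add_iff 1]
    refine Summable.of_nonneg_of_le (fun _ => abs_nonneg _) (fun n => hle 1 (n + 1) le_rfl
      (by omega)) (((summable_nat_add_iff 1).2 hgs).mul_left _)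
  refine ⟨C * ∑' n, g n, mul_nonneg hC0 (tsum_nonneg hg0), fun K hK t ht => ?_⟩
  have hsum := hasSum_legendre hξ hs ht
  have hdec := hsum.summable.sum_add_tsum_nat_add (K + 1)
  rw [hsum.tsum_eq] at hdec
  have heval : (legTrunc K ξ).eval t =
      ∑ n ∈ Finset.range (K + 1), legCoeff n ξ * (legendre n).eval t := by
    simp [legTrunc, eval_finsetSum]
  have herr : (legTrunc K ξ).eval t - ξ t =
      -∑' n, legCoeff (n + (K + 1)) ξ * (legendre (n + (K + 1))).eval t := by
    rw [heval, ← hdec]; ring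
  have hgK : Summable fun n => C * (K : ℝ) ^ (-q) * g (n + (K + 1)) :=
    ((summable_nat_add_iff (K + 1)).2 hgs).mul_left _
  rw [herr, abs_neg]
  have h1 : |∑' n, legCoeff (n + (K + 1)) ξ * (legendre (n + (K + 1))).eval t| ≤
      ∑' n, C * (K : ℝ) ^ (-q) * g (n + (K + 1)) := by
    rw [← Real.norm_eq_abs]
    refine tsum_of_norm_bounded hgK.hasSum fun n => ?_
    rw [norm_mul, Real.norm_eq_abs, Real.norm_eq_abs]
    exact (mul_le_of_le_one_right (abs_nonneg _) (abs_legendre_le_one _ ht)).trans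
      (hle K _ hK (by omega))
  refine h1.trans ?_
  rw [tsum_mul_left]
  have h2 : ∑' n, g (n + (K + 1)) ≤ ∑' n, g n := by
    rw [← hgs.sum_add_tsum_nat_add (K + 1)]
    exact le_add_of_nonneg_left (Finset.sum_nonneg fun n _ => hg0 n)
  have h3 : 0 ≤ C * (K : ℝ) ^ (-q) := by positivity
  calc _ ≤ C * (K : ℝ) ^ (-q) * ∑' n, g n := mul_le_mul_of_nonneg_left h2 h3
    _ = _ := by ring

/-- The rate of the truncated Legendre series for the derivative of order `i` of `Y 0`, if the
derivative of order `m > i` has bounded variation. -/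
lemma exists_legTrunc_rate {Y : ℕ → ℝ → ℝ} {m i : ℕ} (him : i < m)
    (hY : ∀ j < m, IsPrimitive (Y j) (Y (j + 1))) (hYm : Integrable (Y m) mu)
    (hV : essVariation (Y m) ≠ ⊤) :
    ∃ C, 0 ≤ C ∧ ∀ K : ℕ, 1 ≤ K → ∀ t ∈ Icc (-1 : ℝ) 1,
      |(legTrunc K (Y i)).eval t - Y i t| ≤ C * (K : ℝ) ^ (-((m : ℝ) - i - 3 / 4)) := by
  have hdecay : ∀ s ≤ m, ∃ C, ∀ n : ℕ, 1 ≤ n →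
      |legInner n (Y (m - s))| ≤ C * (n : ℝ) ^ (-((s : ℝ) + 3 / 2)) := by
    intro s
    induction s with
    | zero =>
      intro _
      refine ⟨totalVariation (Y m), fun n hn => (abs_legInner_le hYm hV hn).trans ?_⟩
      have hn0 : (0 : ℝ) < n := by exact_mod_cast hn
      have hsq : 0 < √(n : ℝ) := Real.sqrt_pos.2 hn0
      rw [Nat.cast_zero, zero_add, Real.rpow_neg hn0.le, rpow_three_halves hn, ← div_eq_mul_inv]
      refine div_le_div_of_nonneg_left ENNReal.toReal_nonneg (by positivity) ?_
      nlinarith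
    | succ s ih =>
      intro hs
      have hp := hY (m - (s + 1)) (by omega)
      rw [show m - (s + 1) + 1 = m - s by omega] at hp
      obtain ⟨C, hC⟩ := hp.legInner_decay (by positivity) (ih (by omega))
      refine ⟨C, fun n hn => ?_⟩
      have := hC n hn
      rwa [show (s : ℝ) + 3 / 2 + 1 = ((s + 1 : ℕ) : ℝ) + 3 / 2 by push_cast; ring] at this
  obtain ⟨C, hC⟩ := hdecay (m - i) (by omega)
  rw [Nat.sub_sub_self him.le] at hC
  have hC0 : 0 ≤ C := by simpa using (abs_nonneg _).trans (hC 1 le_rfl)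
  have hcast : ((m - i : ℕ) : ℝ) = (m : ℝ) - i := by rw [Nat.cast_sub him.le]
  have hmi : (i : ℝ) + 1 ≤ m := by exact_mod_cast him
  refine abs_legTrunc_sub_le (hY i him).continuousOn (by linarith) ⟨2 * C, fun n hn => ?_⟩
  have hn0 : (1 : ℝ) ≤ n := by exact_mod_cast hn
  have h1 := hC n hn
  rw [hcast] at h1
  have h2 : (n : ℝ) ^ (-((m : ℝ) - i - 3 / 4 + 5 / 4)) =
      (n : ℝ) ^ (-((m : ℝ) - i + 3 / 2)) * n := by
    rw [← Real.rpow_add_one (by positivity)]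
    congr 1; ring
  rw [legCoeff, abs_mul, abs_of_pos (by positivity), h2]
  have h3 : 0 ≤ C * (n : ℝ) ^ (-((m : ℝ) - i + 3 / 2)) := (abs_nonneg _).trans h1
  calc _ ≤ (2 * (n : ℝ)) * (C * (n : ℝ) ^ (-((m : ℝ) - i + 3 / 2))) :=
        mul_le_mul (by linarith) h1 (abs_nonneg _) (by positivity)
    _ = _ := by ring

/-! ### Chains of primitives and of polynomials -/

lemma exists_polynomial_primitive (p : ℝ[X]) (c : ℝ) :
    ∃ P : ℝ[X], derivative P = p ∧ P.eval (-1) = c ∧ P.natDegree ≤ p.natDegree + 1 := by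
  set Q : ℝ[X] := ∑ n ∈ Finset.range (p.natDegree + 1), C (p.coeff n / (n + 1)) * X ^ (n + 1)
  have hQ : derivative Q = p := by
    conv_rhs => rw [p.as_sum_range_C_mul_X_pow]
    rw [derivative_sum]
    refine Finset.sum_congr rfl fun n _ => ?_
    have hn : (n : ℝ) + 1 ≠ 0 := by positivity
    rw [derivative_C_mul_X_pow, Nat.add_sub_cancel]
    push_cast
    rw [div_mul_cancel₀ _ hn]
  have hdeg : Q.natDegree ≤ p.natDegree + 1 := natDegree_sum_le_of_forall_le _ _ fun n hn =>
    (natDegree_C_mul_X_pow_le _ _).trans (Finset.mem_range.1 hn)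
  refine ⟨Q + C (c - Q.eval (-1)), by rw [derivative_add, derivative_C, add_zero, hQ],
    by simp, (natDegree_add_le _ _).trans (max_le hdeg (by simp))⟩

/-- Integrating an approximation `p` of `Z 0` repeatedly, with the exact initial values, gives
approximations of the iterated primitives `Z i`; each integration over `[-1, t]` at most doubles the
error. -/
lemma exists_polynomial_chain {R : ℕ} {Z : ℕ → ℝ → ℝ}
    (hZ : ∀ i < R, IsPrimitive (Z (i + 1)) (Z i)) (p : ℝ[X]) {ε : ℝ}
    (hp : ∀ t ∈ Icc (-1 : ℝ) 1, |p.eval t - Z 0 t| ≤ ε) :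
    ∃ P : ℕ → ℝ[X], P 0 = p ∧ (∀ i, derivative (P (i + 1)) = P i) ∧
      (∀ i, (P i).natDegree ≤ p.natDegree + i) ∧ (∀ i, (P (i + 1)).eval (-1) = Z (i + 1) (-1)) ∧
      ∀ i ≤ R, ∀ t ∈ Icc (-1 : ℝ) 1, |(P i).eval t - Z i t| ≤ 2 ^ i * ε := by
  choose A hA1 hA2 hA3 using exists_polynomial_primitive
  set P : ℕ → ℝ[X] := fun i => Nat.rec p (fun i q => A q (Z (i + 1) (-1))) i with hP
  have hsucc : ∀ i, P (i + 1) = A (P i) (Z (i + 1) (-1)) := fun i => rfl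
  have hd : ∀ i, derivative (P (i + 1)) = P i := fun i => by rw [hsucc, hA1]
  have hv : ∀ i, (P (i + 1)).eval (-1) = Z (i + 1) (-1) := fun i => by rw [hsucc, hA2]
  refine ⟨P, rfl, hd, fun i => ?_, hv, fun i => ?_⟩
  · induction i with
    | zero => rfl
    | succ i ih =>
      have := hA3 (P i) (Z (i + 1) (-1))
      rw [hsucc]
      omega
  · induction i with
    | zero => intro _ t ht; simpa [hP] using hp t ht
    | succ i ih =>
      intro hi t ht
      have hprim := hZ i hi
      have hint : IntervalIntegrable (Z i) volume (-1) t := hprim.intervalIntegrable.mono_set (by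
        rw [uIcc_of_le ht.1, uIcc_of_le (by norm_num)]
        exact Icc_subset_Icc le_rfl ht.2)
      have hPint := (P i).continuous.intervalIntegrable (μ := volume) (-1) t
      have h1 : (P (i + 1)).eval t - Z (i + 1) t =
          ∫ s in (-1 : ℝ)..t, ((P i).eval s - Z i s) := by
        have h2 := intervalIntegral.integral_eq_sub_of_hasDerivAt (a := -1) (b := t)
          (fun s _ => by rw [← hd i]; exact (P (i + 1)).hasDerivAt s) hPint
        rw [intervalIntegral.integral_sub hPint hint, h2, hprim.eq t ht, hv]
        ring
      have h3 := intervalIntegral.norm_integral_le_of_norm_le_const (a := -1) (b := t)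
        (f := fun s => (P i).eval s - Z i s) (C := 2 ^ i * ε) fun s hs => by
          rw [uIoc_of_le ht.1] at hs
          exact ih (by omega) s ⟨hs.1.le, hs.2.trans ht.2⟩
      have h4 : 0 ≤ 2 ^ i * ε := (abs_nonneg _).trans (ih (by omega) t ht)
      rw [h1, ← Real.norm_eq_abs]
      refine h3.trans ?_
      rw [abs_of_nonneg (by linarith [ht.1]), pow_succ]
      nlinarith [ht.2]

lemma iterate_derivative_chain {P : ℕ → ℝ[X]} (h : ∀ i, derivative (P (i + 1)) = P i) {l i : ℕ}
    (hl : l ≤ i) : derivative^[l] (P i) = P (i - l) := by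
  induction l with
  | zero => rfl
  | succ l ih =>
    rw [Function.iterate_succ_apply', ih (by omega), show i - l = i - (l + 1) + 1 by omega, h]

lemma specCoeff_eval_node {N m₁ n : ℕ} (hN : 1 ≤ N) {p : ℝ[X]} (hp : p.natDegree ≤ N)
    (hn : n + (derivative^[m₁] p).natDegree ≤ 2 * N - 1) :
    specCoeff N m₁ (fun k => p.eval (node N k)) n =
      ((n : ℝ) + 1 / 2) * polyInt (legendre n * derivative^[m₁] p) := by
  rw [specCoeff, diffMatrix_pow_mulVec hN hp, polyInt_eq_sum_weight hN (natDegree_mul_le.trans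
    ((Nat.add_le_add_right (natDegree_legendre_le n) _).trans hn))]
  congr 1
  exact Finset.sum_congr rfl fun k _ => by rw [eval_mul]; ring

/-! ### Regularity of feasible trajectories -/

lemma ae_mu_of_forall_Icc {p : ℝ → Prop} (h : ∀ t ∈ Icc (-1 : ℝ) 1, p t) : ∀ᵐ t ∂mu, p t := by
  rw [mu_eq_restrict_Icc]
  exact (ae_restrict_iff' measurableSet_Icc).2 (.of_forall h)

lemma le_on_Icc_of_ae_le {f : ℝ → ℝ} {c : ℝ} (hf : ContinuousOn f (Icc (-1) 1))
    (h : ∀ᵐ t ∂mu, f t ≤ c) : ∀ t ∈ Icc (-1 : ℝ) 1, f t ≤ c := by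
  have h1 : (fun t => max (f t) c) =ᵐ[mu] fun _ => c := by
    filter_upwards [h] with t ht using max_eq_right ht
  exact fun t ht => max_eq_right_iff.1
    (eqOn_Icc_of_ae_eq_mu h1 (hf.sup continuousOn_const) continuousOn_const ht)

lemma essVariation_congr {ξ η : ℝ → ℝ} (h : ξ =ᵐ[mu] η) : essVariation ξ = essVariation η :=
  iInf_congr fun _ => iInf_congr_Prop ⟨fun hw => hw.trans h, fun hw => hw.trans h.symm⟩
    fun _ => rfl

/-- The derivatives of `x_r` and the other components of the state form one chain of primitives:
`Z 0 = x_r^{(m₁)}`, …, `Z m₁ = x_r`, …, `Z (m₁ + r - 1) = x_1`. -/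
lemma ProblemB.IsFeasible.exists_chain {r Ne Nh : ℕ} [NeZero r] {P : ProblemB r Ne Nh}
    {x : ℝ → Fin r → ℝ} {u : ℝ → ℝ} (hfeas : P.IsFeasible x u) {m m₁ : ℕ} (hm : m₁ < m)
    {Y : ℕ → ℝ → ℝ} (hY : ∀ j < m, IsPrimitive (Y j) (Y (j + 1)))
    (hY0 : EqOn (Y 0) (fun t => x t (lastIdx r)) (Icc (-1) 1)) :
    ∃ Z : ℕ → ℝ → ℝ, (∀ j ≤ m₁, Z j = Y (m₁ - j)) ∧
      (∀ i : Fin r, EqOn (Z (m₁ + (r - 1 - i))) (fun t => x t i) (Icc (-1) 1)) ∧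
      ∀ i < m₁ + (r - 1), IsPrimitive (Z (i + 1)) (Z i) := by
  have hr : 0 < r := NeZero.pos r
  set Z : ℕ → ℝ → ℝ := fun j => if j ≤ m₁ then Y (m₁ - j) else
    fun t => x t ⟨r - 1 - (j - m₁), by omega⟩ with hZ
  have hZ1 : ∀ j ≤ m₁, Z j = Y (m₁ - j) := fun j hj => if_pos hj
  have hZ2 : ∀ i : Fin r, EqOn (Z (m₁ + (r - 1 - i))) (fun t => x t i) (Icc (-1) 1) := by
    intro i
    have hi := i.2
    by_cases h : (i : ℕ) = r - 1
    · have hi' : i = lastIdx r := Fin.ext h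
      rw [show m₁ + (r - 1 - (i : ℕ)) = m₁ by omega, hZ1 m₁ le_rfl, Nat.sub_self, hi']
      exact hY0
    · rw [hZ]
      simp only
      rw [if_neg (by omega)]
      intro t _
      simp only
      congr 1
      ext
      simp only
      omega
  have hcont : ∀ i : Fin r, ContinuousOn (fun t => x t i) (Icc (-1) 1) := fun i =>
    continuousOn_pi.1 hfeas.cont i
  refine ⟨Z, hZ1, hZ2, fun i hi => ?_⟩
  rcases lt_or_ge i m₁ with h | h
  · rw [hZ1 i h.le, hZ1 (i + 1) h]
    have := hY (m₁ - (i + 1)) (by omega)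
    rwa [show m₁ - (i + 1) + 1 = m₁ - i by omega] at this
  · set a : Fin r := ⟨r - 1 - (i + 1 - m₁), by omega⟩ with ha
    set b : Fin r := ⟨r - 1 - (i - m₁), by omega⟩ with hb
    have hprim := (hfeas.chain a b (by simp only [ha, hb]; omega)).isPrimitive
      (integrable_mu_of_continuousOn (hcont b)) (hcont a)
    have h1 := hZ2 a
    have h2 := hZ2 b
    rw [show m₁ + (r - 1 - (a : ℕ)) = i + 1 by simp only [ha]; omega] at h1
    rw [show m₁ + (r - 1 - (b : ℕ)) = i by simp only [hb]; omega] at h2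
    exact hprim.congr h1.symm (ae_mu_of_forall_Icc fun t ht => (h2 ht).symm)

/-! ### Lipschitz estimates on compact sets -/

lemma exists_dist_le_of_locallyLipschitz {α β : Type*} [MetricSpace α] [MetricSpace β] {F : α → β}
    (hF : LocallyLipschitz F) {S : Set α} (hS : IsCompact S) :
    ∃ L : ℝ, 0 ≤ L ∧ ∀ a ∈ S, ∀ b ∈ S, dist (F a) (F b) ≤ L * dist a b := by
  obtain ⟨L, hL⟩ := LocallyLipschitzOn.exists_lipschitzOnWith_of_compact hS hF.locallyLipschitzOn
  exact ⟨L, L.2, fun a ha b hb => hL.dist_le_mul a ha b hb⟩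

/-- The control that realizes the velocity `v` in the state `a` depends on `(v, a)` in a Lipschitz
continuous way as long as `a` stays in a compact set. -/
lemma exists_control_lipschitz {r Ne Nh : ℕ} (P : ProblemB r Ne Nh) {S : Set (Fin r → ℝ)}
    (hS : IsCompact S) {B : ℝ} (hB : 0 ≤ B) :
    ∃ L : ℝ, 0 ≤ L ∧ ∀ a ∈ S, ∀ a' ∈ S, ∀ v v' w : ℝ, v' = P.f a' + P.g a' * w → |w| ≤ B →
      |(v - P.f a) / P.g a - w| ≤ L * (|v - v'| + dist a a') := by
  obtain ⟨Lf, hLf0, hLf⟩ := exists_dist_le_of_locallyLipschitz P.lip_f hS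
  obtain ⟨Lg, hLg0, hLg⟩ := exists_dist_le_of_locallyLipschitz P.lip_g hS
  obtain ⟨G, hG⟩ := hS.exists_bound_of_continuousOn (f := fun a => (P.g a)⁻¹)
    (P.lip_g.continuous.continuousOn.inv₀ fun a _ => P.g_ne_zero a)
  refine ⟨max G 0 * (1 + Lf + Lg * B), by positivity, fun a ha a' ha' v v' w hv hw => ?_⟩
  have hga := P.g_ne_zero a
  have h1 : (v - P.f a) / P.g a - w =
      (P.g a)⁻¹ * ((v - v') + (P.f a' - P.f a) + (P.g a' - P.g a) * w) := by
    rw [hv]; field_simp; ring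
  have h2 := (hG a ha).trans (le_max_left G 0)
  have h3 := hLf a' ha' a ha
  have h4 := hLg a' ha' a ha
  rw [Real.dist_eq, dist_comm a' a] at h3 h4
  rw [Real.norm_eq_abs] at h2
  have hd : 0 ≤ dist a a' := dist_nonneg
  have hvv : 0 ≤ |v - v'| := abs_nonneg _
  have h5 : |(v - v') + (P.f a' - P.f a) + (P.g a' - P.g a) * w| ≤
      (1 + Lf + Lg * B) * (|v - v'| + dist a a') := by
    have e1 : |(P.g a' - P.g a) * w| ≤ Lg * dist a a' * B := by
      rw [abs_mul]
      exact mul_le_mul h4 hw (abs_nonneg _) (by positivity)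
    have e2 := abs_add_three (v - v') (P.f a' - P.f a) ((P.g a' - P.g a) * w)
    have e3 : 0 ≤ Lf * |v - v'| := by positivity
    have e4 : 0 ≤ Lg * B * |v - v'| := by positivity
    nlinarith
  rw [h1, abs_mul, mul_assoc]
  exact mul_le_mul h2 h5 (abs_nonneg _) (le_max_right _ _)

/-- The approximation error is eventually smaller than the tolerance of the discretized
constraints. -/
lemma exists_threshold (r m₁ : ℕ) {D δ σ β : ℝ} (hδ : 0 < δ) (hβ : 0 < β)
    (hβσ : β < σ) :
    ∃ N₁ : ℕ, 0 < N₁ ∧ ∀ N : ℕ, N₁ ≤ N → r + m₁ ≤ N ∧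
      D * ((N : ℝ) - r - m₁ + 1) ^ (-σ) ≤ δ ∧
      D * ((N : ℝ) - r - m₁ + 1) ^ (-σ) ≤ ((N : ℝ) - r - 1) ^ (-β) := by
  have hlim : ∀ c q : ℝ, 0 < q →
      Filter.Tendsto (fun k : ℕ => c * (k : ℝ) ^ (-q)) Filter.atTop (nhds 0) := by
    intro c q hq
    have := ((tendsto_rpow_neg_atTop hq).comp tendsto_natCast_atTop_atTop).const_mul c
    simpa using this
  have e1 := (hlim D σ (hβ.trans hβσ)).eventually_le_const hδ
  have e2 := (hlim (D * 2 ^ β) (σ - β) (by linarith)).eventually_le_const one_pos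
  obtain ⟨k₀, hk₀⟩ := Filter.eventually_atTop.1 (e1.and e2)
  refine ⟨k₀ + r + 2 * m₁ + 2, by omega, fun N hN => ?_⟩
  obtain ⟨k, hk⟩ : ∃ k, N = k + r + m₁ - 1 ∧ k₀ ≤ k ∧ m₁ + 3 ≤ k :=
    ⟨N + 1 - r - m₁, by omega, by omega, by omega⟩
  obtain ⟨hNk, hk0, hk1⟩ := hk
  have hNr : (N : ℝ) + 1 = k + r + m₁ := by
    have : N + 1 = k + r + m₁ := by omega
    exact_mod_cast this
  rw [show (N : ℝ) - r - m₁ + 1 = k by linarith, show (N : ℝ) - r - 1 = k + m₁ - 2 by linarith]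
  obtain ⟨f1, f2⟩ := hk₀ k hk0
  have hk2 : (m₁ : ℝ) + 3 ≤ k := by exact_mod_cast hk1
  have hm0 : (0 : ℝ) ≤ m₁ := m₁.cast_nonneg
  have hkpos : (0 : ℝ) < k := by linarith
  refine ⟨by omega, f1, ?_⟩
  have g1 : (2 * (k : ℝ)) ^ (-β) ≤ ((k : ℝ) + m₁ - 2) ^ (-β) :=
    Real.rpow_le_rpow_of_nonpos (by linarith) (by linarith) (by linarith)
  refine le_trans ?_ g1
  have g2 : (k : ℝ) ^ (-σ) = (k : ℝ) ^ (-(σ - β)) * (k : ℝ) ^ (-β) := by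
    rw [← Real.rpow_add hkpos]; congr 1; ring
  have g3 : (2 * (k : ℝ)) ^ (-β) = (2 : ℝ) ^ (-β) * (k : ℝ) ^ (-β) :=
    Real.mul_rpow (by norm_num) hkpos.le
  have g4 : D * (k : ℝ) ^ (-(σ - β)) ≤ (2 : ℝ) ^ (-β) := by
    rw [Real.rpow_neg (by norm_num : (0 : ℝ) ≤ 2), ← one_div,
      le_div_iff₀ (Real.rpow_pos_of_pos (by norm_num) _)]
    linarith
  rw [g2, g3, ← mul_assoc]
  exact mul_le_mul_of_nonneg_right g4 (by positivity)

/-! ### Properties of the discretized trajectory -/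

/-- The nodal values of the polynomials that approximate the components of the state: component `i`
is the polynomial number `m₁ + (r - 1 - i)` of the chain. -/
def nodalState {r : ℕ} (m₁ N : ℕ) (Q : ℕ → ℝ[X]) (k : Fin (N + 1)) (i : Fin r) : ℝ :=
  (Q (m₁ + (r - 1 - i))).eval (node N k)

section NodalState

variable {r m₁ N : ℕ} {Q : ℕ → ℝ[X]}

lemma interp_nodalState (hN : 1 ≤ N) (hdeg : ∀ i ≤ m₁ + (r - 1), (Q i).natDegree ≤ N) (i : Fin r) :
    interp N (fun k => nodalState m₁ N Q k i) = Q (m₁ + (r - 1 - i)) :=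
  interp_eval_node hN (hdeg _ (by omega))

lemma interpState_nodalState (hN : 1 ≤ N) (hdeg : ∀ i ≤ m₁ + (r - 1), (Q i).natDegree ≤ N) (t : ℝ)
    (i : Fin r) : interpState (nodalState (r := r) m₁ N Q) t i =
      (Q (m₁ + (r - 1 - i))).eval t := by
  rw [interpState, interp_nodalState hN hdeg]

lemma nodalState_lastIdx [NeZero r] (k : Fin (N + 1)) :
    nodalState m₁ N Q k (lastIdx r) = (Q m₁).eval (node N k) := by
  simp [nodalState, lastIdx]

lemma interpState_node (hN : 1 ≤ N) (hdeg : ∀ i ≤ m₁ + (r - 1), (Q i).natDegree ≤ N)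
    (k : Fin (N + 1)) : interpState (nodalState (r := r) m₁ N Q) (node N k) =
      nodalState m₁ N Q k :=
  funext fun i => interpState_nodalState hN hdeg _ i

lemma interpControl_nodalState [NeZero r] {Ne Nh : ℕ} (P : ProblemB r Ne Nh) (hN : 1 ≤ N)
    (hm₁ : 1 ≤ m₁) (hdeg : ∀ i ≤ m₁ + (r - 1), (Q i).natDegree ≤ N)
    (hQ : ∀ i, derivative (Q (i + 1)) = Q i) (t : ℝ) :
    P.interpControl (nodalState m₁ N Q) t =
      ((Q (m₁ - 1)).eval t - P.f (interpState (nodalState m₁ N Q) t)) /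
        P.g (interpState (nodalState m₁ N Q) t) := by
  have h1 : Q (m₁ + (r - 1 - (lastIdx r : ℕ))) = Q m₁ := by simp [lastIdx]
  have h2 : derivative (Q m₁) = Q (m₁ - 1) := by
    have := hQ (m₁ - 1)
    rwa [Nat.sub_add_cancel hm₁] at this
  rw [ProblemB.interpControl, interp_nodalState hN hdeg, h1, h2]

lemma diffMatrix_mulVec_nodalState (hN : 1 ≤ N)
    (hdeg : ∀ i ≤ m₁ + (r - 1), (Q i).natDegree ≤ N)
    (hQ : ∀ i, derivative (Q (i + 1)) = Q i) {i j : Fin r} (hij : (j : ℕ) = i + 1) :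
    diffMatrix N *ᵥ (fun k => nodalState m₁ N Q k i) = fun k => nodalState m₁ N Q k j := by
  have hj := j.2
  simp only [nodalState]
  rw [diffMatrix_mulVec hN (hdeg _ (by omega)),
    show m₁ + (r - 1 - (i : ℕ)) = m₁ + (r - 1 - (j : ℕ)) + 1 by omega, hQ]

end NodalState

lemma specCoeff_chain {r m₁ N K : ℕ} {Q : ℕ → ℝ[X]} {ξ : ℝ → ℝ} (hr : 1 ≤ r) (hm₁ : 1 ≤ m₁)
    (hK : K + r + m₁ = N + 1) (hQ0 : Q 0 = legTrunc K ξ) (hQ : ∀ i, derivative (Q (i + 1)) = Q i)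
    (hdeg : (Q m₁).natDegree ≤ N) {n : ℕ} (hn : n + r ≤ N) :
    specCoeff N m₁ (fun k => (Q m₁).eval (node N k)) n = if n ≤ K then legCoeff n ξ else 0 := by
  have h1 : derivative^[m₁] (Q m₁) = legTrunc K ξ := by
    rw [iterate_derivative_chain hQ le_rfl, Nat.sub_self, hQ0]
  have h2 := natDegree_legTrunc_le K ξ
  rw [specCoeff_eval_node (by omega) hdeg (by rw [h1]; omega), h1, polyInt_legendre_mul_legTrunc,
    legCoeff, mul_ite, mul_zero]

/-- The sum of the absolute values of the Legendre coefficients is bounded with `ζ(3/2)`. -/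
lemma sum_abs_legCoeff_le {ξ : ℝ → ℝ} {A : ℝ} (K : ℕ)
    (h : ∀ n : ℕ, 1 ≤ n → |legCoeff n ξ| ≤ 6 * A / (√Real.pi * (n : ℝ) ^ (3 / 2 : ℝ)))
    (hA : 0 ≤ A) :
    ∑ n ∈ Finset.range (K + 1), |legCoeff n ξ| ≤
      |(1 / 2) * ∫ t, ξ t ∂mu| + 6 / √Real.pi * A * zetaThreeHalves := by
  have h0 : legCoeff 0 ξ = (1 / 2) * ∫ t, ξ t ∂mu := by
    simp [legCoeff, legInner, legendre_zero]
  have hs : Summable fun k : ℕ => 1 / ((k : ℝ) + 1) ^ (3 / 2 : ℝ) := by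
    have := (summable_nat_add_iff 1).2 (Real.summable_one_div_nat_rpow.2
      (by norm_num : (1 : ℝ) < 3 / 2))
    simpa using this
  rw [Finset.sum_range_succ', h0, add_comm]
  refine add_le_add le_rfl ?_
  calc ∑ k ∈ Finset.range K, |legCoeff (k + 1) ξ|
      ≤ ∑ k ∈ Finset.range K, 6 / √Real.pi * A * (1 / ((k : ℝ) + 1) ^ (3 / 2 : ℝ)) := by
        refine Finset.sum_le_sum fun k _ => (h (k + 1) (by omega)).trans (le_of_eq ?_)
        push_cast
        field_simp
    _ = 6 / √Real.pi * A * ∑ k ∈ Finset.range K, 1 / ((k : ℝ) + 1) ^ (3 / 2 : ℝ) := by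
        rw [Finset.mul_sum]
    _ ≤ _ := by
        refine mul_le_mul_of_nonneg_left ?_ (by positivity)
        exact hs.sum_le_tsum _ fun k _ => by positivity

lemma eLpNorm_top_le_of_ae {f : ℝ → ℝ} {c d : ℝ} (h : ∀ᵐ t ∂mu, |f t| ≤ c) (hcd : c ≤ d) :
    eLpNorm f ⊤ mu ≤ ENNReal.ofReal d := by
  rw [eLpNorm_exponent_top]
  exact (eLpNormEssSup_le_of_ae_bound h).trans (ENNReal.ofReal_le_ofReal hcd)

lemma weakDeriv_ae_eq_zero_of_sobolevNorm_eq_zero {m : ℕ} {ξ : ℝ → ℝ}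
    (h : ∀ j ≤ m, MemLp (weakDeriv j ξ) ⊤ mu) (h0 : sobolevNorm m 2 ξ = 0) :
    ∀ j ≤ m, weakDeriv j ξ =ᵐ[mu] 0 := by
  intro j hj
  have h1 := (Finset.sum_eq_zero_iff_of_nonneg fun _ _ => ENNReal.toReal_nonneg).1 h0 j
    (Finset.mem_range.2 (Nat.lt_succ_of_le hj))
  have h2 : MemLp (weakDeriv j ξ) 2 mu := (h j hj).mono_exponent le_top
  rw [ENNReal.toReal_eq_zero_iff, or_iff_left h2.eLpNorm_ne_top] at h1
  exact (eLpNorm_eq_zero_iff h2.1 two_ne_zero).1 h1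

/-- The error of the truncated Legendre series, relative to the Sobolev norm, with a constant that
depends on `ξ`. If the Sobolev norm is zero, all weak derivatives vanish, and with them the
truncated series and the error. -/
lemma exists_legTrunc_rate_sobolevNorm {ξ : ℝ → ℝ} {Y : ℕ → ℝ → ℝ} {m i : ℕ} (him : i < m)
    (hY : ∀ j < m, IsPrimitive (Y j) (Y (j + 1)))
    (hYξ : ∀ j ≤ m, Y j =ᵐ[mu] weakDeriv j ξ ∧ MemLp (Y j) ⊤ mu)
    (hV : essVariation (Y m) ≠ ⊤) :
    ∃ C, 0 ≤ C ∧ ∀ K : ℕ, 1 ≤ K → ∀ t ∈ Icc (-1 : ℝ) 1,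
      |(legTrunc K (Y i)).eval t - Y i t| ≤
        C * sobolevNorm m 2 ξ * (K : ℝ) ^ (-((m : ℝ) - i - 3 / 4)) := by
  have hn0 : 0 ≤ sobolevNorm m 2 ξ := Finset.sum_nonneg fun _ _ => ENNReal.toReal_nonneg
  rcases hn0.eq_or_lt with h | h
  · refine ⟨0, le_rfl, fun K _ t ht => ?_⟩
    have h1 := weakDeriv_ae_eq_zero_of_sobolevNorm_eq_zero
      (fun j hj => (hYξ j hj).2.ae_eq (hYξ j hj).1) h.symm i him.le
    have h2 : EqOn (Y i) 0 (Icc (-1) 1) := eqOn_Icc_of_ae_eq_mu ((hYξ i him.le).1.trans h1)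
      (hY i him).continuousOn continuousOn_const
    have h3 : ∀ n, legCoeff n (Y i) = 0 := fun n => by
      rw [legCoeff, legInner, integral_congr_ae (g := fun _ => 0), integral_zero, mul_zero]
      exact ae_mu_of_forall_Icc fun t ht => by simp [h2 ht]
    rw [h2 ht, legTrunc]
    simp [h3]
  · obtain ⟨C, hC0, hC⟩ := exists_legTrunc_rate him hY ((hYξ m le_rfl).2.integrable le_top) hV
    refine ⟨C / sobolevNorm m 2 ξ, by positivity, fun K hK t ht => ?_⟩
    rw [div_mul_cancel₀ _ h.ne']
    exact hC K hK t ht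

end PSControl

end

open PSControl

theorem mainTheorem4 {r Ne Nh : ℕ} [NeZero r] (P : PSControl.ProblemB r Ne Nh)
    (x : ℝ → Fin r → ℝ) (u : ℝ → ℝ) (hfeas : P.IsFeasible x u)
    (m m₁ : ℕ) (hm : 2 ≤ m)
    (hbv : PSControl.HasBVWeakDeriv m (fun t => x t (PSControl.lastIdx r)))
    (hm₁ : 1 ≤ m₁) (hm₁m : m₁ ≤ m - 1) :
    ∃ M : ℝ, 0 < M ∧
      ∀ (β : ℝ), 0 < β → β < (m : ℝ) - m₁ - 3 / 4 →
      ∀ b : PSControl.SearchBounds r, b.LargeEnough m₁ x u →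
      ∃ N₁ : ℕ, 0 < N₁ ∧ ∀ N : ℕ, N₁ ≤ N →
        ∃ (X : Fin (N + 1) → Fin r → ℝ) (U : Fin (N + 1) → ℝ),
          P.IsDiscreteFeasible m₁ β b N X U ∧ P.Estimates x u m m₁ M N X := by
  have hr : 1 ≤ r := NeZero.one_le
  set y : ℝ → ℝ := fun t => x t (lastIdx r) with hy
  set σ : ℝ := (m : ℝ) - m₁ - 3 / 4 with hσ
  obtain ⟨Y, hY, hYw⟩ := MemSobolev.exists_primitives hbv.1
  have hYy : ∀ j ≤ m, Y j =ᵐ[mu] weakDeriv j y ∧ MemLp (Y j) ⊤ mu := fun j hj => (hYw j hj).2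
  have hVm : essVariation (Y m) ≠ ⊤ := by
    rw [essVariation_congr (hYy m le_rfl).1]; exact hbv.2
  have hcontx : ∀ i : Fin r, ContinuousOn (fun t => x t i) (Icc (-1) 1) := fun i =>
    continuousOn_pi.1 hfeas.cont i
  have hYcont : ∀ j < m, ContinuousOn (Y j) (Icc (-1) 1) := fun j hj => (hY j hj).continuousOn
  have hY0 : EqOn (Y 0) y (Icc (-1) 1) := by
    refine eqOn_Icc_of_ae_eq_mu ?_ (hYcont 0 (by omega)) (hcontx _)
    exact (hYy 0 (by omega)).1.trans
      ((hYw 0 (by omega)).1.ae_unique (hasWeakDeriv_zero hfeas.last.locInt))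
  obtain ⟨Z, hZY, hZx, hZ⟩ := hfeas.exists_chain (m₁ := m₁) (by omega : m₁ < m) hY hY0
  have hZ0 : Z 0 = Y m₁ := hZY 0 (by omega)
  -- the continuous representative of the control
  set w : ℝ → ℝ := fun t => (Y 1 t - P.f (x t)) / P.g (x t) with hw
  have hwcont : ContinuousOn w (Icc (-1) 1) :=
    ((hYcont 1 (by omega)).sub (P.lip_f.continuous.comp_continuousOn hfeas.cont)).div
      (P.lip_g.continuous.comp_continuousOn hfeas.cont) fun t _ => P.g_ne_zero _
  have hwY : ∀ t, Y 1 t = P.f (x t) + P.g (x t) * w t := fun t => by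
    simp only [hw]
    field_simp [P.g_ne_zero (x t)]
    ring
  have hwu : w =ᵐ[mu] u := by
    have h1 := (hYy 1 (by omega)).1.trans ((hYw 1 (by omega)).1.ae_unique hfeas.last)
    filter_upwards [h1] with t ht
    simp only [hw, ht, add_sub_cancel_left, mul_div_cancel_left₀ _ (P.g_ne_zero (x t))]
  have hpath : ∀ i, ∀ t ∈ Icc (-1 : ℝ) 1, P.h (x t, w t) i ≤ 0 := fun i => by
    refine le_on_Icc_of_ae_le ((continuous_apply i).comp_continuousOn
      (P.lip_h.continuous.comp_continuousOn (hfeas.cont.prodMk hwcont))) ?_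
    filter_upwards [hfeas.path, hwu] with t h1 h2
    simpa [h2] using h1 i
  -- compact sets that contain the trajectory and its approximations
  obtain ⟨B₀, hB₀⟩ := isCompact_Icc.exists_bound_of_continuousOn hfeas.cont
  obtain ⟨W₀, hW₀⟩ := isCompact_Icc.exists_bound_of_continuousOn hwcont
  have hW₀0 : 0 ≤ W₀ := (norm_nonneg _).trans (hW₀ 1 (by simp))
  set S : Set (Fin r → ℝ) := Metric.closedBall 0 (B₀ + 1) with hS
  have hScpt : IsCompact S := isCompact_closedBall _ _
  have hxS : ∀ t ∈ Icc (-1 : ℝ) 1, x t ∈ S := fun t ht => by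
    rw [hS, mem_closedBall_zero_iff]
    linarith [hB₀ t ht]
  have hnearS : ∀ t ∈ Icc (-1 : ℝ) 1, ∀ a, dist a (x t) ≤ 1 → a ∈ S := fun t ht a ha => by
    have h1 := hB₀ t ht
    rw [hS, Metric.mem_closedBall]
    rw [← dist_zero_right] at h1
    linarith [dist_triangle a (x t) 0]
  set T : Set ((Fin r → ℝ) × ℝ) := S ×ˢ Metric.closedBall 0 (W₀ + 1) with hT
  have hTcpt : IsCompact T := hScpt.prod (isCompact_closedBall _ _)
  obtain ⟨L, hL0, hL⟩ := exists_control_lipschitz P hScpt hW₀0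
  obtain ⟨Lh, hLh0, hLh⟩ := exists_dist_le_of_locallyLipschitz P.lip_h hTcpt
  obtain ⟨Le, hLe0, hLe⟩ := exists_dist_le_of_locallyLipschitz P.lip_e (hScpt.prod hScpt)
  -- the rate of approximation, and the bound for the spectral coefficients
  obtain ⟨C, hC0, hC⟩ := exists_legTrunc_rate_sobolevNorm (by omega : m₁ < m) hY hYy hVm
  have hprim : IsPrimitive (Y m₁) (weakDeriv (m₁ + 1) y) :=
    (hY m₁ (by omega)).congr (fun _ _ => rfl) (hYy (m₁ + 1) (by omega)).1
  have hVm₁ : essVariation (weakDeriv (m₁ + 1) y) ≠ ⊤ := by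
    rw [← essVariation_congr (hYy (m₁ + 1) (by omega)).1]
    rcases eq_or_ne (m₁ + 1) m with h | h
    · rw [h]; exact hVm
    · exact (hY (m₁ + 1) (by omega)).essVariation_ne_top
  have hspec : ∀ n : ℕ, 1 ≤ n → |legCoeff n (Y m₁)| ≤
      6 * (supBound (weakDeriv (m₁ + 1) y) + totalVariation (weakDeriv (m₁ + 1) y)) /
        (√Real.pi * (n : ℝ) ^ (3 / 2 : ℝ)) := fun n hn =>
    hprim.abs_coeff_le ((hYy (m₁ + 1) (by omega)).2.ae_eq (hYy (m₁ + 1) (by omega)).1) hVm₁ hn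
  set Λ := sobolevNorm m 2 y with hΛ
  have hΛ0 : 0 ≤ Λ := Finset.sum_nonneg fun _ _ => ENNReal.toReal_nonneg
  set R := m₁ + (r - 1) with hR
  -- `A` bounds the amplification of the error in the state and the control
  set A : ℝ := 2 ^ R * (2 * L + 1) with hA
  have hRA : (2 : ℝ) ^ R ≤ A := le_mul_of_one_le_right (by positivity) (by linarith)
  have hA0 : 0 < A := lt_of_lt_of_le (by positivity) hRA
  refine ⟨A * C + 1, by positivity, fun β hβ hβσ b hb => ?_⟩
  obtain ⟨ε₀, hε₀, hbox⟩ := hb.box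
  have hboxx : ∀ i, ∀ t ∈ Icc (-1 : ℝ) 1, b.lo i + ε₀ ≤ x t i ∧ x t i ≤ b.hi i - ε₀ := by
    intro i t ht
    refine ⟨?_, le_on_Icc_of_ae_le (hcontx i) (by
      filter_upwards [hbox] with t ht using (ht.1 i).2) t ht⟩
    have := le_on_Icc_of_ae_le (c := -(b.lo i + ε₀)) (hcontx i).neg (by
      filter_upwards [hbox] with t ht
      simpa using (ht.1 i).1) t ht
    simp only [Pi.neg_apply] at this
    linarith
  have hboxw : ∀ t ∈ Icc (-1 : ℝ) 1, b.loU + ε₀ ≤ w t ∧ w t ≤ b.hiU - ε₀ := by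
    intro t ht
    refine ⟨?_, le_on_Icc_of_ae_le hwcont (by
      filter_upwards [hbox, hwu] with t ht h2 using h2 ▸ ht.2.2) t ht⟩
    have := le_on_Icc_of_ae_le (c := -(b.loU + ε₀)) hwcont.neg (by
      filter_upwards [hbox, hwu] with t ht h2
      simp only [Pi.neg_apply, h2]
      linarith [ht.2.1]) t ht
    simp only [Pi.neg_apply] at this
    linarith
  obtain ⟨N₁, hN₁, hthr⟩ := exists_threshold r m₁ (D := A * (C * Λ) * (1 + Lh + Le))
    (δ := min 1 ε₀) (lt_min one_pos hε₀) hβ hβσ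
  refine ⟨N₁, hN₁, fun N hN => ?_⟩
  obtain ⟨hrN, hδ, htol⟩ := hthr N hN
  obtain ⟨K, hK⟩ : ∃ K, K + r + m₁ = N + 1 := ⟨N + 1 - r - m₁, by omega⟩
  have hK1 : 1 ≤ K := by omega
  have hN1 : 1 ≤ N := by omega
  have hKr : (N : ℝ) - r - m₁ + 1 = K := by
    have : ((K + r + m₁ : ℕ) : ℝ) = ((N + 1 : ℕ) : ℝ) := by rw [hK]
    push_cast at this
    linarith
  rw [hKr] at hδ htol
  set ε : ℝ := C * Λ * (K : ℝ) ^ (-σ) with hε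
  have hε0 : 0 ≤ ε := by positivity
  have hAε0 : 0 ≤ A * ε := by positivity
  have hfac : A * (C * Λ) * (1 + Lh + Le) * (K : ℝ) ^ (-σ) = (1 + Lh + Le) * (A * ε) := by
    rw [hε]; ring
  rw [hfac] at hδ htol
  have hAε : A * ε ≤ min 1 ε₀ := by
    refine le_trans ?_ hδ
    nlinarith [mul_nonneg (add_nonneg hLh0 hLe0) hAε0]
  have hAε1 : A * ε ≤ 1 := hAε.trans (min_le_left _ _)
  have hAε2 : A * ε ≤ ε₀ := hAε.trans (min_le_right _ _)
  have htolh : Lh * (A * ε) ≤ ((N : ℝ) - r - 1) ^ (-β) := by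
    refine le_trans ?_ htol
    nlinarith [mul_nonneg hLe0 hAε0]
  have htole : Le * (A * ε) ≤ ((N : ℝ) - r - 1) ^ (-β) := by
    refine le_trans ?_ htol
    nlinarith [mul_nonneg hLh0 hAε0]
  have hρ : A * ε ≤ (A * C + 1) * Λ / ((N : ℝ) - r - m₁ + 1) ^ σ := by
    rw [hKr, hε, Real.rpow_neg K.cast_nonneg, div_eq_mul_inv, ← mul_assoc, ← mul_assoc]
    refine mul_le_mul_of_nonneg_right ?_ (by positivity)
    linarith
  -- the polynomials of the discretized trajectory
  obtain ⟨Q, hQ0, hQ, hQdeg, hQv, hQerr⟩ := exists_polynomial_chain hZ (legTrunc K (Y m₁)) (ε := ε)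
    fun t ht => by rw [hZ0]; exact hC K hK1 t ht
  have hdeg : ∀ i ≤ R, (Q i).natDegree ≤ N := fun i hi => by
    have h1 := hQdeg i
    have h2 := natDegree_legTrunc_le K (Y m₁)
    omega
  have hQerr' : ∀ i ≤ R, ∀ t ∈ Icc (-1 : ℝ) 1, |(Q i).eval t - Z i t| ≤ 2 ^ R * ε :=
    fun i hi t ht => (hQerr i hi t ht).trans
      (mul_le_mul_of_nonneg_right (pow_le_pow_right₀ (by norm_num) hi) hε0)
  have hRε : 2 ^ R * ε ≤ A * ε := mul_le_mul_of_nonneg_right hRA hε0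
  set X : Fin (N + 1) → Fin r → ℝ := nodalState m₁ N Q with hX
  have hXt : ∀ t i, interpState X t i = (Q (m₁ + (r - 1 - i))).eval t :=
    interpState_nodalState hN1 hdeg
  have herrx : ∀ t ∈ Icc (-1 : ℝ) 1, ∀ i, |interpState X t i - x t i| ≤ 2 ^ R * ε := by
    intro t ht i
    have h1 := hQerr' (m₁ + (r - 1 - i)) (by omega) t ht
    rw [hZx i ht] at h1
    rwa [hXt]
  have hdistx : ∀ t ∈ Icc (-1 : ℝ) 1, dist (interpState X t) (x t) ≤ 2 ^ R * ε := fun t ht =>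
    (dist_pi_le_iff (by positivity)).2 fun i => herrx t ht i
  have hXS : ∀ t ∈ Icc (-1 : ℝ) 1, interpState X t ∈ S := fun t ht =>
    hnearS t ht _ ((hdistx t ht).trans (hRε.trans hAε1))
  have herru : ∀ t ∈ Icc (-1 : ℝ) 1, |P.interpControl X t - w t| ≤ A * ε := by
    intro t ht
    have h1 : |(Q (m₁ - 1)).eval t - Y 1 t| ≤ 2 ^ R * ε := by
      have := hQerr' (m₁ - 1) (by omega) t ht
      rwa [hZY (m₁ - 1) (by omega), show m₁ - (m₁ - 1) = 1 by omega] at this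
    have h2 := hL _ (hXS t ht) _ (hxS t ht) ((Q (m₁ - 1)).eval t) (Y 1 t) (w t) (hwY t) (hW₀ t ht)
    rw [← interpControl_nodalState P hN1 hm₁ hdeg hQ] at h2
    refine h2.trans ?_
    calc L * (|(Q (m₁ - 1)).eval t - Y 1 t| + dist (interpState X t) (x t))
        ≤ L * (2 ^ R * ε + 2 ^ R * ε) :=
          mul_le_mul_of_nonneg_left (add_le_add h1 (hdistx t ht)) hL0
      _ ≤ A * ε := by
          rw [hA]
          have : 0 ≤ 2 ^ R * ε := by positivity
          linarith
  have hnode : ∀ k, node N k ∈ Icc (-1 : ℝ) 1 := node_mem_Icc hN1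
  have hXnode : ∀ k, interpState X (node N k) = X k := interpState_node hN1 hdeg
  have hlast : (fun k => X k (lastIdx r)) = fun k => (Q m₁).eval (node N k) :=
    funext fun k => nodalState_lastIdx k
  have hspecX : ∀ n, n + r ≤ N → specCoeff N m₁ (fun k => X k (lastIdx r)) n =
      if n ≤ K then legCoeff n (Y m₁) else 0 := fun n hn => by
    rw [hlast]
    exact specCoeff_chain hr hm₁ hK hQ0 hQ (hdeg m₁ (by omega)) hn
  have hX0 : X 0 = x (-1) := by
    funext i
    have h1 := hZx i (show (-1 : ℝ) ∈ Icc (-1 : ℝ) 1 by simp)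
    have h2 := hQv (m₁ + (r - 1 - i) - 1)
    rw [show m₁ + (r - 1 - (i : ℕ)) - 1 + 1 = m₁ + (r - 1 - (i : ℕ)) by omega] at h2
    rw [hX, nodalState, node_zero hN1, h2, h1]
  refine ⟨X, fun k => P.interpControl X (node N k), ?_, ?_⟩
  · refine ⟨fun i j hij => diffMatrix_mulVec_nodalState hN1 hdeg hQ hij, ?_, ?_, ?_, ?_, ?_, ?_, ?_⟩
    · funext k
      rw [hlast, diffMatrix_mulVec hN1 (hdeg m₁ (by omega)),
        interpControl_nodalState P hN1 hm₁ hdeg hQ,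
        hXnode, mul_div_cancel₀ _ (P.g_ne_zero _), add_sub_cancel]
      have := hQ (m₁ - 1)
      rw [Nat.sub_add_cancel hm₁] at this
      rw [this]
    · have h1 : dist (X (Fin.last N)) (x 1) ≤ A * ε := by
        have := hdistx 1 (by simp)
        rw [← node_last hN1, hXnode, node_last hN1] at this
        exact this.trans hRε
      have h2 := hLe (X 0, X (Fin.last N)) ⟨hX0 ▸ hxS (-1) (by simp), by
        have := hXS _ (hnode (Fin.last N))
        rwa [hXnode] at this⟩ (x (-1), x 1) ⟨hxS _ (by simp), hxS _ (by simp)⟩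
      rw [hfeas.endpoint, dist_zero_right, Prod.dist_eq, hX0, dist_self,
        max_eq_right dist_nonneg] at h2
      rw [hX0]
      exact h2.trans ((mul_le_mul_of_nonneg_left h1 hLe0).trans htole)
    · intro k i
      have hk := hnode k
      have d1 : dist (X k) (x (node N k)) ≤ A * ε := by
        have := hdistx _ hk
        rw [hXnode] at this
        exact this.trans hRε
      have d2 := herru _ hk
      have hmem : (X k, P.interpControl X (node N k)) ∈ T := by
        refine ⟨hnearS _ hk _ (d1.trans hAε1), ?_⟩
        have h1 := hW₀ _ hk
        rw [mem_closedBall_zero_iff, Real.norm_eq_abs]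
        rw [Real.norm_eq_abs] at h1
        have := abs_sub_abs_le_abs_sub (P.interpControl X (node N k)) (w (node N k))
        linarith
      have hmem' : (x (node N k), w (node N k)) ∈ T := by
        refine ⟨hxS _ hk, ?_⟩
        rw [mem_closedBall_zero_iff]
        linarith [hW₀ _ hk]
      have h2 := (dist_le_pi_dist _ _ i).trans (hLh _ hmem _ hmem')
      rw [Prod.dist_eq, Real.dist_eq] at h2
      have h3 : max (dist (X k) (x (node N k)))
          (dist (P.interpControl X (node N k)) (w (node N k))) ≤ A * ε := max_le d1 d2
      have h4 := (le_abs_self _).trans (h2.trans (mul_le_mul_of_nonneg_left h3 hLh0))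
      linarith [hpath i _ hk]
    · intro k i
      have h1 := herrx _ (hnode k) i
      rw [hXnode, abs_le] at h1
      have h2 := hboxx i _ (hnode k)
      constructor <;> linarith [h1.1, h1.2, h2.1, h2.2]
    · intro k
      have h1 := abs_le.1 (herru _ (hnode k))
      have h2 := hboxw _ (hnode k)
      constructor <;> linarith [h1.1, h1.2, h2.1, h2.2]
    · intro j hj1 hj2
      obtain ⟨v, hv1, hv2, hv3, hv4⟩ := hb.deriv j hj1 hj2
      have h1 : v (-1) = Y j (-1) := eqOn_Icc_of_ae_eq_mu
        (hv2.trans (hYy j (by omega)).1.symm) hv1 (hYcont j (by omega)) (by simp)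
      have h2 : ((diffMatrix N ^ j) *ᵥ fun k => X k (lastIdx r)) 0 = v (-1) := by
        have h3 := hQv (m₁ - j - 1)
        rw [show m₁ - j - 1 + 1 = m₁ - j by omega, hZY (m₁ - j) (by omega),
          show m₁ - (m₁ - j) = j by omega] at h3
        rw [hlast, diffMatrix_pow_mulVec hN1 (hdeg m₁ (by omega)),
          iterate_derivative_chain hQ (by omega)]
        simp only [node_zero hN1, h3, h1]
      rw [h2]
      exact ⟨hv3.le, hv4.le⟩
    · rw [show N + 2 - r - m₁ = K + 1 by omega]
      have h1 : ∑ n ∈ Finset.range (K + 1), |specCoeff N m₁ (fun k => X k (lastIdx r)) n| =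
          ∑ n ∈ Finset.range (K + 1), |legCoeff n (Y m₁)| := by
        refine Finset.sum_congr rfl fun n hn => ?_
        have hn := Finset.mem_range.1 hn
        rw [hspecX n (by omega), if_pos (by omega)]
      rw [h1]
      have h2 := sum_abs_legCoeff_le K hspec
        (add_nonneg ENNReal.toReal_nonneg ENNReal.toReal_nonneg)
      rw [integral_congr_ae (hYy m₁ (by omega)).1] at h2
      exact h2.trans hb.coeff.le
  · refine ⟨fun i => ?_, fun l hl1 hl2 => ?_, ?_, fun n hn1 hn2 => ?_⟩
    · exact eLpNorm_top_le_of_ae (ae_mu_of_forall_Icc fun t ht => herrx t ht i) (hRε.trans hρ)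
    · refine eLpNorm_top_le_of_ae (c := 2 ^ R * ε) ?_ (hRε.trans hρ)
      have h1 : interp N (fun k => X k (lastIdx r)) = Q m₁ := by
        rw [hlast, interp_eval_node hN1 (hdeg m₁ (by omega))]
      rw [h1, iterate_derivative_chain hQ hl2]
      have h2 := ae_mu_of_forall_Icc fun t ht => hQerr' (m₁ - l) (by omega) t ht
      rw [hZY (m₁ - l) (by omega), show m₁ - (m₁ - l) = l by omega] at h2
      filter_upwards [h2, (hYy l (by omega)).1] with t ht1 ht2
      rwa [← ht2]
    · refine eLpNorm_top_le_of_ae (c := A * ε) ?_ hρ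
      filter_upwards [ae_mu_of_forall_Icc herru, hwu] with t ht1 ht2
      rwa [← ht2]
    · rw [hspecX n hn2]
      split_ifs
      · exact hspec n hn1
      · rw [abs_zero]
        have hU0 : 0 ≤ supBound (weakDeriv (m₁ + 1) y) := ENNReal.toReal_nonneg
        have hV0 : 0 ≤ totalVariation (weakDeriv (m₁ + 1) y) := ENNReal.toReal_nonneg
        positivity
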